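/- Let $K$ be a field of characteristic $0$, $N$ a positive integer, and let $q^{1/2}\in K$ be a primitive $2N$-th root of unity. Let $k$ be an integer with $-N/2\le k<0$, and put $q=(q^{1/2})^2$, $t^{1/2}=q^{k/2}=(q^{1/2})^k$. The double affine Hecke algebra $\mathcal H\!\mathcal H$ of type $A_1$ is the $K$-algebra generated by $X^{\pm1},T_0,T_1,\pi$ with the relations $(T_i-t^{1/2})(T_i+t^{-1/2})=0$, $\pi^2=1$, $\pi T_1\pi^{-1}=T_0$, $T_1XT_1=X^{-1}$, $T_0X^{-1}T_0=q^{-1}X$, $\pi X\pi^{-1}=q^{1/2}X^{-1}$; put $Y=\pi T_1$. It acts on $\mathcal V=K[X,X^{-1}]$ by multiplication by $X^{\pm 1}$, $\pi f(X)=f(q^{1/2}X^{-1})$, $T_1=t^{1/2}s+(t^{1/2}-t^{-1/2})(X^2-1)^{-1}(s-1)$ with $sf(X)=f(X^{-1})$, and $T_0=\pi T_1\pi^{-1}$. Let $Rad$ be the radical of the pairing $\{f,g\}=\big(f(Y^{-1})g\big)(q^{-k/2})$ on $\mathcal V$. For $m\in\mathbb Z$ let $\lambda_m=-(m+\mathrm{sgn}(m)k)/2$,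 where $\mathrm{sgn}(0)=-1$. Write $c\succ m$ if either $|c|<|m|$ and $c\equiv m \bmod 2$, or $c=|m|=-m>0$. A polynomial $E_m$ is an element $E_m\in X^m+\sum_{c\succ m}KX^c$ with $YE_m=q^{\lambda_m}E_m$; it is said to exist if there is such an element. i) $Rad$ is an $\mathcal H\!\mathcal H$-submodule of $\mathcal V$, and $V=\mathcal V/Rad$ is an irreducible $\mathcal H\!\mathcal H$-module of dimension $2N+4|k|$. ii) $E_m$ exists, is unique, and $E_m(q^{-k/2})\ne0$ for the sequences $$m=0,1,-1,\ldots,-|k|+1,|k|;$$ $$m=-2|k|,2|k|+1,\ldots,-N+1,N;$$ $$m=-N,N+1,\ldots,-N-|k|+1,N+|k|,$$ which have respectively $2|k|$, $2(N-2|k|)$ and $2|k|$ elements. $E_m$ does not exist for the $2|k|+2|k|$ indices $$m=-|k|,|k|+1,\ldots,-2|k|+1,2|k|;\qquad m=-N-|k|,N+|k|+1,\ldots,-N-2|k|+1,N+2|k|.$$ iii) Let the $Y$-semisimple component of $V$ be the sum of the generalized $Y$-eigenspaces on which $Y$ is diagonalizable. It has dimension $2N-4|k|$ and is spanned by the images of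 $E_m$ for $m=-2|k|,2|k|+1,-2|k|-1,\ldots,-N+1,N$. The corresponding $Y$-weights (with $\lambda$ standing for the eigenvalue $q^\lambda$) are $$\lambda=\frac{|k|}2,\frac{-|k|-1}2,\frac{|k|+1}2,\ldots,\frac{N-1-|k|}2,\frac{|k|-N}2 ;$$ these eigenvalues are pairwise distinct and have one-dimensional generalized eigenspaces in $V$. iv) The sum of the remaining generalized $Y$-eigenspaces is a complement of the $Y$-semisimple component. It has dimension $8|k|$ and is the direct sum of $4|k|$ Jordan $2$-blocks, namely of the generalized eigenspaces for the $4|k|$ pairwise distinct eigenvalues $q^\lambda$, where $\lambda$ runs through $$\frac{-|k|}2,\frac{|k|-1}2,\ldots,\frac{-1}2,\frac02\qquad\text{and}\qquad \frac{N-|k|}2,\frac{|k|-N-1}2,\ldots,\frac{N-1}2,\frac{-N}2 ,$$ each of these generalized eigenspaces being a single Jordan block of size $2$. -/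

import Mathlib

namespace AOne

noncomputable section

open LaurentPolynomial

/-! ### The double affine Hecke algebra of type `A₁`

The parameters are units `v = q^{1/2}` and `u = t^{1/2}` of a field `K`. -/

/-- Generators: `X = X_ω`, its inverse, `T₀`, `T₁`, and `π`, the nontrivial element of `Π = P/Q`. -/
inductive Gen
  | X
  | Xinv
  | T0
  | T1
  | pi

/-- A generator as an element of the free algebra. -/
abbrev gen (K : Type*) [Field K] (g : Gen) : FreeAlgebra K Gen := FreeAlgebra.ι K g

/-- A scalar as an element of the free algebra. -/
abbrev scal {K : Type*} [Field K] (c : Kˣ) : FreeAlgebra K Gen :=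
  algebraMap K (FreeAlgebra K Gen) (c : K)

/-- The defining relations. (There is no braid relation between `T₀` and `T₁` in type `A₁`.) -/
inductive Rel (K : Type*) [Field K] (v u : Kˣ) : FreeAlgebra K Gen → FreeAlgebra K Gen → Prop
  | X_mul_Xinv : Rel K v u (gen K .X * gen K .Xinv) 1
  | Xinv_mul_X : Rel K v u (gen K .Xinv * gen K .X) 1
  | quad_zero : Rel K v u ((gen K .T0 - scal u) * (gen K .T0 + scal u⁻¹)) 0
  | quad_one : Rel K v u ((gen K .T1 - scal u) * (gen K .T1 + scal u⁻¹)) 0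
  | pi_sq : Rel K v u (gen K .pi * gen K .pi) 1
  | pi_T1 : Rel K v u (gen K .pi * gen K .T1) (gen K .T0 * gen K .pi)
  | pi_T0 : Rel K v u (gen K .pi * gen K .T0) (gen K .T1 * gen K .pi)
  | T1_X_T1 : Rel K v u (gen K .T1 * gen K .X * gen K .T1) (gen K .Xinv)
  /-- `T₀ X⁻¹ T₀ = X⁻¹ X_{α₀}⁻¹` with `X_{α₀} = q X⁻²`. -/
  | T0_Xinv_T0 : Rel K v u (gen K .T0 * gen K .Xinv * gen K .T0) (scal (v⁻¹ ^ 2) * gen K .X)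
  /-- `π X π⁻¹ = q^{1/2} X⁻¹`. -/
  | pi_X : Rel K v u (gen K .pi * gen K .X) (scal v * gen K .Xinv * gen K .pi)

/-- The double affine Hecke algebra of type `A₁`. -/
abbrev DAHA (K : Type*) [Field K] (v u : Kˣ) : Type _ := RingQuot (Rel K v u)

section Algebra

variable (K : Type*) [Field K] (v u : Kˣ)

/-- The image of a generator in the algebra. -/
def ofGen (g : Gen) : DAHA K v u := RingQuot.mkAlgHom K (Rel K v u) (gen K g)

theorem pi_mul_pi : ofGen K v u .pi * ofGen K v u .pi = 1 := by
  simpa [ofGen] using RingQuot.mkAlgHom_rel K (Rel.pi_sq (K := K) (v := v) (u := u))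

theorem T1_quad :
    (ofGen K v u .T1 - algebraMap K _ (u : K)) *
      (ofGen K v u .T1 + algebraMap K _ ((u⁻¹ : Kˣ) : K)) = 0 := by
  have h := RingQuot.mkAlgHom_rel K (Rel.quad_one (K := K) (v := v) (u := u))
  simpa only [ofGen, scal, map_mul, map_sub, map_add, AlgHom.commutes, map_zero] using h

/-- `T₁⁻¹ = T₁ - (t^{1/2} - t^{-1/2})`. -/
def T1inv : DAHA K v u :=
  ofGen K v u .T1 - algebraMap K _ ((u : K) - ((u⁻¹ : Kˣ) : K))

theorem T1_mul_T1inv : ofGen K v u .T1 * T1inv K v u = 1 := by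
  have h := T1_quad K v u
  have e : algebraMap K (DAHA K v u) (u : K) * algebraMap K _ ((u⁻¹ : Kˣ) : K) = 1 := by
    rw [← map_mul, Units.mul_inv, map_one]
  have c := Algebra.commutes (u : K) (ofGen K v u .T1)
  rw [sub_mul, mul_add, mul_add, e] at h
  rw [T1inv, map_sub, mul_sub, mul_sub, ← c]
  rw [← sub_eq_zero, ← h]
  abel

theorem T1inv_mul_T1 : T1inv K v u * ofGen K v u .T1 = 1 := by
  rw [← T1_mul_T1inv K v u, T1inv, sub_mul, mul_sub, Algebra.commutes]

/-- `Y = Y_ω = π T₁`, an invertible element of the algebra. -/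
def Y : (DAHA K v u)ˣ where
  val := ofGen K v u .pi * ofGen K v u .T1
  inv := T1inv K v u * ofGen K v u .pi
  val_inv := by
    rw [mul_assoc, ← mul_assoc (ofGen K v u .T1), T1_mul_T1inv, one_mul, pi_mul_pi]
  inv_val := by
    rw [mul_assoc, ← mul_assoc (ofGen K v u .pi), pi_mul_pi, one_mul, T1inv_mul_T1]

end Algebra

/-! ### The polynomial representation -/

section Operators

variable {K : Type*} [Field K]

/-- The linear operator on Laurent polynomials with prescribed values on the monomials. -/
def onMonomials (F : ℤ → LaurentPolynomial K) : Module.End K (LaurentPolynomial K) :=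
  (AddMonoidAlgebra.basis ℤ K).constr K F

@[simp] theorem onMonomials_T (F : ℤ → LaurentPolynomial K) (b : ℤ) :
    onMonomials F (T b) = F b := by
  rw [onMonomials, show (T b : LaurentPolynomial K) = AddMonoidAlgebra.basis ℤ K b from rfl,
    Module.Basis.constr_basis]

theorem end_ext {A B : Module.End K (LaurentPolynomial K)} (h : ∀ b : ℤ, A (T b) = B (T b)) :
    A = B :=
  (AddMonoidAlgebra.basis ℤ K).ext h

/-- Multiplication by `X^n`. -/
def mulX (n : ℤ) : Module.End K (LaurentPolynomial K) := LinearMap.mulLeft K (T n)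

/-- `π(f)(X) = f(q^{1/2} X⁻¹)`. -/
def piOp (v : Kˣ) : Module.End K (LaurentPolynomial K) :=
  onMonomials fun b => C ((v ^ b : Kˣ) : K) * T (-b)

/-- The divided difference `f ↦ (f(X⁻¹) - f(X)) / (X² - 1)`, given on monomials. -/
def divDiff : Module.End K (LaurentPolynomial K) :=
  onMonomials fun b =>
    if 0 ≤ b then -∑ i ∈ Finset.range b.toNat, T (2 * (i : ℤ) - b)
    else ∑ i ∈ Finset.range (-b).toNat, T (2 * (i : ℤ) + b)

theorem geom_aux (n : ℕ) : ∀ a : ℤ,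
    ((T 2 : LaurentPolynomial K) - 1) * ∑ i ∈ Finset.range n, T (2 * (i : ℤ) + a) =
      T (2 * (n : ℤ) + a) - T a := by
  intro a
  induction n with
  | zero => simp
  | succ n ih =>
    rw [Finset.sum_range_succ, mul_add, ih, sub_mul, ← T_add, one_mul]
    have : (2 : ℤ) + (2 * (n : ℤ) + a) = 2 * ((n + 1 : ℕ) : ℤ) + a := by push_cast; ring
    rw [this]; ring

/-- The operator `divDiff` is the divided difference. -/
theorem divDiff_spec (f : LaurentPolynomial K) :
    (T 2 - 1) * divDiff f = invert f - f := by
  have : (LinearMap.mulLeft K ((T 2 : LaurentPolynomial K) - 1)) * divDiff =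
      (invert (R := K)).toLinearMap - 1 := by
    apply end_ext
    intro b
    simp only [Module.End.mul_apply, LinearMap.mulLeft_apply, divDiff, onMonomials_T,
      LinearMap.sub_apply, Module.End.one_apply, AlgEquiv.toLinearMap_apply, invert_T]
    split_ifs with h
    · have h1 : ((b.toNat : ℕ) : ℤ) = b := Int.toNat_of_nonneg h
      have := geom_aux (K := K) b.toNat (-b)
      simp only [← sub_eq_add_neg] at this
      rw [mul_neg, this, h1]
      rw [show 2 * b - b = b by ring]; ring
    · have h1 : (((-b).toNat : ℕ) : ℤ) = -b := Int.toNat_of_nonneg (by omega)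
      rw [geom_aux (K := K) (-b).toNat b, h1]
      rw [show 2 * -b + b = -b by ring]
  simpa using congrArg (fun A => A f) this

/-- The Demazure–Lusztig operator `t^{1/2} s + (t^{1/2} - t^{-1/2}) (X² - 1)⁻¹ (s - 1)`,
where `s(f)(X) = f(X⁻¹)`. -/
def heckeOp (u : Kˣ) : Module.End K (LaurentPolynomial K) :=
  (u : K) • (invert (R := K)).toLinearMap + ((u : K) - ((u⁻¹ : Kˣ) : K)) • divDiff

theorem T_two_sub_one_ne_zero : (T 2 : LaurentPolynomial K) - 1 ≠ 0 := by
  intro h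
  have := congrArg (fun p : LaurentPolynomial K => p.coeff 2) (sub_eq_zero.mp h)
  rw [← T_zero, T_apply, T_apply] at this
  norm_num at this

theorem divDiff_eq {f g : LaurentPolynomial K} (h : (T 2 - 1) * g = invert f - f) :
    divDiff f = g :=
  mul_left_cancel₀ T_two_sub_one_ne_zero ((divDiff_spec f).trans h.symm)

theorem TT (n : ℤ) : (T n : LaurentPolynomial K) * T (-n) = 1 := by
  rw [← T_add, add_neg_cancel, T_zero]

theorem invert_divDiff (f : LaurentPolynomial K) :
    invert (divDiff f) = T 2 * divDiff f := by
  have h := congrArg (invert (R := K)) (divDiff_spec f)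
  have h2 := divDiff_spec f
  have i2 : invert (invert f) = f := involutive_invert f
  simp only [map_mul, map_sub, map_one, invert_T, i2] at h
  have e := TT (K := K) 2
  apply mul_left_cancel₀ (T_two_sub_one_ne_zero (K := K))
  linear_combination (-T 2 : LaurentPolynomial K) * h + (invert (divDiff f)) * e - T 2 * h2

theorem divDiff_invert (f : LaurentPolynomial K) : divDiff (invert f) = -divDiff f := by
  apply divDiff_eq
  rw [show invert (invert f) = f from involutive_invert f]
  linear_combination -divDiff_spec f

theorem divDiff_divDiff (f : LaurentPolynomial K) : divDiff (divDiff f) = divDiff f := by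
  apply divDiff_eq
  rw [invert_divDiff]; ring

theorem divDiff_X (f : LaurentPolynomial K) :
    divDiff (T 1 * f) = T (-1) * divDiff f - T (-1) * f := by
  apply divDiff_eq
  have e := TT (K := K) 1
  have e2 : (T 2 : LaurentPolynomial K) = T 1 * T 1 := by rw [← T_add]; rfl
  have h := divDiff_spec f
  simp only [map_mul, invert_T]
  rw [e2] at h ⊢
  linear_combination T (-1) * h - (T 1 * f) * e

theorem heckeOp_apply (u : Kˣ) (f : LaurentPolynomial K) :
    heckeOp u f = C (u : K) * invert f + (C (u : K) - C ((u⁻¹ : Kˣ) : K)) * divDiff f := by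
  simp [heckeOp, smul_eq_C_mul]

theorem CC (u : Kˣ) : (C (u : K) : LaurentPolynomial K) * C ((u⁻¹ : Kˣ) : K) = 1 := by
  rw [← map_mul, Units.mul_inv, map_one]

theorem divDiff_C_mul (a : K) (f : LaurentPolynomial K) :
    divDiff (C a * f) = C a * divDiff f := by
  rw [← smul_eq_C_mul, map_smul, smul_eq_C_mul]

theorem hecke_sq (u : Kˣ) (f : LaurentPolynomial K) :
    heckeOp u (heckeOp u f) =
      (C (u : K) - C ((u⁻¹ : Kˣ) : K)) * heckeOp u f + f := by
  have i2 : invert (invert f) = f := involutive_invert f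
  have h := divDiff_spec f
  have e := CC u
  simp only [heckeOp_apply, map_add, map_mul, map_sub, invert_C, sub_mul, divDiff_C_mul,
    invert_divDiff, divDiff_invert, divDiff_divDiff, i2]
  linear_combination (C (u : K) * C (u : K) - C (u : K) * C ((u⁻¹ : Kˣ) : K)) * h +
    f * e

theorem hecke_X (u : Kˣ) (f : LaurentPolynomial K) :
    heckeOp u (T 1 * heckeOp u f) = T (-1) * f := by
  have i2 : invert (invert f) = f := involutive_invert f
  have h := divDiff_spec f
  have e := CC u
  have e2 : (T 2 : LaurentPolynomial K) = T 1 * T 1 := by rw [← T_add]; rfl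
  have hc : C (u : K) - C ((u⁻¹ : Kˣ) : K) = C ((u : K) - ((u⁻¹ : Kˣ) : K)) := (map_sub C _ _).symm
  simp only [heckeOp_apply, hc, map_add, map_mul, invert_C, divDiff_X, divDiff_C_mul, invert_T,
    invert_divDiff, divDiff_invert, divDiff_divDiff, i2]
  simp only [map_sub]
  rw [e2] at h ⊢
  linear_combination (C (u : K) * (C (u : K) - C ((u⁻¹ : Kˣ) : K)) * T (-1)) * h + (T (-1) * f) * e

theorem piOp_piOp (v : Kˣ) : piOp v * piOp v = 1 := by
  apply end_ext
  intro b
  simp only [Module.End.mul_apply, Module.End.one_apply, piOp, onMonomials_T]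
  rw [← smul_eq_C_mul, map_smul, onMonomials_T, smul_eq_C_mul, ← mul_assoc, zpow_neg, CC,
    one_mul, neg_neg]

theorem piOp_X (v : Kˣ) (n : ℤ) :
    piOp v * mulX n = ((v ^ n : Kˣ) : K) • (mulX (-n) * piOp v) := by
  apply end_ext
  intro b
  simp only [Module.End.mul_apply, LinearMap.smul_apply, mulX, LinearMap.mulLeft_apply,
    ← T_add, piOp, onMonomials_T, smul_eq_C_mul]
  rw [zpow_add, Units.val_mul, map_mul, neg_add, T_add]
  ring

theorem heckeOp_quad (u : Kˣ) :
    (heckeOp u - algebraMap K _ (u : K)) * (heckeOp u + algebraMap K _ ((u⁻¹ : Kˣ) : K)) = 0 := by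
  refine LinearMap.ext fun f => ?_
  simp only [Module.End.mul_apply, LinearMap.sub_apply, LinearMap.add_apply, map_add, map_smul,
    Module.algebraMap_end_apply, hecke_sq, LinearMap.zero_apply]
  simp only [smul_eq_C_mul]
  linear_combination -f * CC u

/-- The operators by which the generators act; `T₀ = π T₁ π⁻¹`. -/
def genOp (v u : Kˣ) : Gen → Module.End K (LaurentPolynomial K)
  | .X => mulX 1
  | .Xinv => mulX (-1)
  | .T0 => piOp v * heckeOp u * piOp v
  | .T1 => heckeOp u
  | .pi => piOp v

theorem mulX_mul (m n : ℤ) : (mulX m : Module.End K (LaurentPolynomial K)) * mulX n =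
    mulX (m + n) := by
  refine LinearMap.ext fun f => ?_
  simp only [mulX, Module.End.mul_apply, LinearMap.mulLeft_apply, T_add m n, mul_assoc]

theorem mulX_zero : (mulX 0 : Module.End K (LaurentPolynomial K)) = 1 := by
  refine LinearMap.ext fun f => ?_
  simp [mulX]

theorem hecke_mulX (u : Kˣ) : heckeOp u * mulX 1 * heckeOp u = mulX (-1) := by
  refine LinearMap.ext fun f => ?_
  exact hecke_X u f

theorem pi_cancel (v : Kˣ) (A : Module.End K (LaurentPolynomial K)) :
    piOp v * (piOp v * A) = A := by
  rw [← mul_assoc, piOp_piOp, one_mul]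

theorem genOp_rel (v u : Kˣ) ⦃a b : FreeAlgebra K Gen⦄ (h : Rel K v u a b) :
    FreeAlgebra.lift K (genOp v u) a = FreeAlgebra.lift K (genOp v u) b := by
  cases h with
  | X_mul_Xinv => simp [gen, genOp, mulX_mul, mulX_zero]
  | Xinv_mul_X => simp [gen, genOp, mulX_mul, mulX_zero]
  | quad_one => simpa [gen, scal, genOp] using heckeOp_quad u
  | quad_zero =>
    have h := congrArg (fun A => piOp v * A * piOp v) (heckeOp_quad u)
    have c (x : K) : algebraMap K (Module.End K (LaurentPolynomial K)) x =
        piOp v * algebraMap K _ x * piOp v := by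
      rw [← Algebra.commutes, mul_assoc, piOp_piOp, mul_one]
    simp only [gen, scal, map_mul, map_sub, map_add, AlgHom.commutes, map_zero,
      FreeAlgebra.lift_ι_apply, genOp]
    rw [c (u : K), c ((u⁻¹ : Kˣ) : K), ← sub_mul, ← mul_sub, ← add_mul, ← mul_add]
    simpa only [mul_assoc, pi_cancel, mul_zero, zero_mul] using h
  | pi_sq => simp [gen, genOp, piOp_piOp]
  | pi_T1 =>
    simp [gen, genOp, mul_assoc, piOp_piOp]
  | pi_T0 =>
    simp [gen, genOp, mul_assoc, pi_cancel]
  | T1_X_T1 => simpa [gen, genOp] using hecke_mulX u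
  | T0_Xinv_T0 =>
    simp only [gen, scal, map_mul, AlgHom.commutes, FreeAlgebra.lift_ι_apply, genOp]
    have h1 : piOp v * mulX (-1) * piOp v = ((v⁻¹ : Kˣ) : K) • mulX 1 := by
      rw [piOp_X, smul_mul_assoc, mul_assoc, piOp_piOp, mul_one, neg_neg, zpow_neg_one]
    calc _ = piOp v * heckeOp u * (piOp v * mulX (-1) * piOp v) * heckeOp u * piOp v := by
          simp only [mul_assoc]
      _ = ((v⁻¹ : Kˣ) : K) • (piOp v * (heckeOp u * mulX 1 * heckeOp u) * piOp v) := by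
          rw [h1]; simp only [mul_assoc, smul_mul_assoc, mul_smul_comm]
      _ = _ := by
          rw [hecke_mulX, h1, smul_smul, ← Algebra.smul_def, Units.val_pow_eq_pow_val, sq]
  | pi_X =>
    simp only [gen, scal, map_mul, AlgHom.commutes, FreeAlgebra.lift_ι_apply, genOp]
    rw [piOp_X, mul_assoc, ← Algebra.smul_def, zpow_one]

/-- The homomorphism from the double affine Hecke algebra to operators on Laurent polynomials. -/
def polyHom (v u : Kˣ) : DAHA K v u →ₐ[K] Module.End K (LaurentPolynomial K) :=
  RingQuot.liftAlgHom K ⟨FreeAlgebra.lift K (genOp v u), genOp_rel v u⟩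

end Operators

/-- The polynomial representation: the space of Laurent polynomials in `X` with the action of
the double affine Hecke algebra. -/
def PolyRep (K : Type*) [Field K] (_v _u : Kˣ) : Type _ := LaurentPolynomial K

section PolyRep

variable (K : Type*) [Field K] (v u : Kˣ)

instance : AddCommGroup (PolyRep K v u) := inferInstanceAs (AddCommGroup (LaurentPolynomial K))

instance : Module K (PolyRep K v u) := inferInstanceAs (Module K (LaurentPolynomial K))

instance : Module (DAHA K v u) (PolyRep K v u) :=
  Module.compHom (LaurentPolynomial K) (polyHom v u).toRingHom

instance : IsScalarTower K (DAHA K v u) (PolyRep K v u) where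
  smul_assoc c h f := by
    change polyHom v u (c • h) f = c • (polyHom v u h f)
    rw [map_smul]; rfl

/-- A vector of the polynomial representation as a Laurent polynomial. -/
def toPoly : PolyRep K v u ≃ₗ[K] LaurentPolynomial K := LinearEquiv.refl K _

/-- Each generator acts by its operator. -/
theorem toPoly_ofGen_smul (g : Gen) (f : PolyRep K v u) :
    toPoly K v u (ofGen K v u g • f) = genOp v u g (toPoly K v u f) := by
  change polyHom v u (ofGen K v u g) f = genOp v u g f
  rw [ofGen, polyHom, RingQuot.liftAlgHom_mkAlgHom_apply, gen, FreeAlgebra.lift_ι_apply]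

/-- The evaluation `f ↦ f(q^{-ρ_k}) = f(t^{-1/2})`. -/
def evalRho : PolyRep K v u →ₗ[K] K := leval K u⁻¹ ∘ₗ (toPoly K v u).toLinearMap

/-- `f ↦ L_{ι(f)} = f(Y⁻¹)`, where `ι(X) = X⁻¹`. -/
def dunkl : PolyRep K v u →ₗ[K] DAHA K v u :=
  leval K (Y K v u) ∘ₗ (invert (R := K)).toLinearMap ∘ₗ (toPoly K v u).toLinearMap

/-- The pairing `{f, g} = (L_{ι(f)} g)(q^{-ρ_k})`. -/
def pairing : PolyRep K v u →ₗ[K] PolyRep K v u →ₗ[K] K :=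
  ((Algebra.lsmul K K (PolyRep K v u)).toLinearMap ∘ₗ dunkl K v u).compr₂ (evalRho K v u)

theorem pairing_apply (f g : PolyRep K v u) :
    pairing K v u f g = evalRho K v u (dunkl K v u f • g) := rfl

/-- The radical of the pairing. -/
def radical : Submodule K (PolyRep K v u) := LinearMap.ker (pairing K v u)

/-- The operator by which `Y` acts in a module over the double affine Hecke algebra. -/
def YOp (M : Type*) [AddCommGroup M] [Module K M] [Module (DAHA K v u) M]
    [IsScalarTower K (DAHA K v u) M] : Module.End K M :=
  Algebra.lsmul K K M (Y K v u : DAHA K v u)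

/-! ### Nonsymmetric Macdonald polynomials -/

/-- The order `c ≻ m` on the weights `P = ℤ` (the index `m` stands for `m ω`, so that
`m_- = -|m|` and `Q_+ = 2 ℤ_+`). -/
def Succeeds (c m : ℤ) : Prop := (|c| < |m| ∧ (2 : ℤ) ∣ |m| - |c|) ∨ (|c| = |m| ∧ m < c)

/-- `q^{λ_m}` for the weight `λ_m = -(m + sgn(m) k)/2`, where `sgn(0) = -1`. -/
def qWeight {K : Type*} [Field K] (v u : Kˣ) (m : ℤ) : Kˣ := v ^ (-m) * (if 0 < m then u⁻¹ else u)

/-- `E` is a polynomial `E_m`: a `Y`-eigenvector of weight `λ_m` such that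
`E - X^m` is a combination of the `X^c` with `c ≻ m`. -/
def IsMacdonald (m : ℤ) (E : PolyRep K v u) : Prop :=
  YOp K v u (PolyRep K v u) E = (qWeight v u m : K) • E ∧
    ∀ c : ℤ, (toPoly K v u E - T m).coeff c ≠ 0 → Succeeds c m

end PolyRep

/-! ### Semisimple part and Jordan blocks of an operator -/

section Jordan

variable {K M : Type*} [Field K] [AddCommGroup M] [Module K M] (A : Module.End K M)

/-- The sum of those generalized eigenspaces of `A` on which `A` is diagonalizable. -/
def semisimplePart : Submodule K M :=
  ⨆ μ : K, ⨆ _ : A.maxGenEigenspace μ = A.eigenspace μ, A.maxGenEigenspace μ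

/-- The sum of those generalized eigenspaces of `A` on which `A` is not diagonalizable. -/
def nonsemisimplePart : Submodule K M :=
  ⨆ μ : K, ⨆ _ : A.maxGenEigenspace μ ≠ A.eigenspace μ, A.maxGenEigenspace μ

/-- `W` is a Jordan block of `A` of size `2` with eigenvalue `μ`. -/
def IsJordanTwoBlock (μ : K) (W : Submodule K M) : Prop :=
  ∃ e f : M, LinearIndependent K ![e, f] ∧ W = Submodule.span K {e, f} ∧
    A e = μ • e ∧ A f = μ • f + e

end Jordan

/-! ### The index sets and weights; here `a = |k|` -/

/-- `0, 1, -1, …, -a+1, a`. -/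
def existFirst (a : ℤ) : Finset ℤ := Finset.Icc (-a + 1) a

/-- `-2a, 2a+1, …, -N+1, N`. -/
def existSecond (N a : ℤ) : Finset ℤ :=
  Finset.Icc (-N + 1) (-2 * a) ∪ Finset.Icc (2 * a + 1) N

/-- `-N, N+1, …, -N-a+1, N+a`. -/
def existThird (N a : ℤ) : Finset ℤ :=
  Finset.Icc (-N - a + 1) (-N) ∪ Finset.Icc (N + 1) (N + a)

/-- `-a, a+1, …, -2a+1, 2a`. -/
def missingFirst (a : ℤ) : Finset ℤ :=
  Finset.Icc (-2 * a + 1) (-a) ∪ Finset.Icc (a + 1) (2 * a)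

/-- `-N-a, N+a+1, …, -N-2a+1, N+2a`. -/
def missingSecond (N a : ℤ) : Finset ℤ :=
  Finset.Icc (-N - 2 * a + 1) (-N - a) ∪ Finset.Icc (N + a + 1) (N + 2 * a)

/-- The numbers `2λ` for the weights `λ = a/2, (-a-1)/2, (a+1)/2, …, (N-1-a)/2, (a-N)/2`. -/
def simpleWeights (N a : ℤ) : Finset ℤ :=
  Finset.Icc a (N - 1 - a) ∪ Finset.Icc (a - N) (-a - 1)

/-- The numbers `2λ` for the weights `λ = -a/2, (a-1)/2, …, -1/2, 0/2`. -/
def doubleWeightsFirst (a : ℤ) : Finset ℤ := Finset.Icc (-a) (a - 1)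

/-- The numbers `2λ` for the weights `λ = (N-a)/2, (a-N-1)/2, …, (N-1)/2, -N/2`. -/
def doubleWeightsSecond (N a : ℤ) : Finset ℤ :=
  Finset.Icc (N - a) (N - 1) ∪ Finset.Icc (-N) (a - N - 1)

end

end AOne

open AOne

/-! Put a = |k|, so that t^{1/2} = v^{-a} and the evaluation point q^{-k/2} is v^a. Everything rests
on an explicit description of the radical: it is the ideal generated by G = `genPoly`, a polynomial
of degree 2N + 4a whose zeros are all the 2N-th roots of unity v^j, double for j in [1-a, a] and
[N-a+1, N+a] modulo 2N and simple otherwise.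

The operators move zeros. π reflects v^j to v^{1-j}. By `hecke_mul`, T₁ reflects v^j to v^{-j}, with
two exceptions: one order can be gained or lost where j ≡ a modulo N, because u X² - u⁻¹ vanishes
there, and at ±1 a simple common zero of f and T₁ f is automatically a double zero of f. Hence the
multiples of G form a submodule. Conversely, a proper submodule containing G has a common zero, and
the reflections spread it to all zeros of G with their multiplicities (`genPoly_dvd_of_mem`).

The generators have adjoints for the pairing, so Rad is a submodule, and {f, X^n} is the value of
Y^{-n} f at v^a (`pairing_T`). Since v^a is a zero of G, the ideal (G) lies in Rad; since {1, 1} =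
1, Rad is proper. Therefore Rad = (G), and the same minimality shows that V = 𝒱/Rad is irreducible.

Y is triangular on the monomials ordered by exponents 0, 1, -1, 2, -2, …, with diagonal entries
q^{λ_m}. The first 2N + 4a monomials are a basis of V, so the dimension of a generalized eigenspace
is the number of these m with the given weight, which is one or two. By `mem_radical_of_eigenvector`
an eigenvector in V is determined by its value at v^a, so eigenspaces are at most lines and every
weight of multiplicity two gives one Jordan block.

E_m exists whenever its weight does not occur below m. It is too short to be a multiple of G, so its
value at v^a is nonzero. If the weight of m already occurs at an earlier c for which E_c exists,
then E_m and a multiple of E_c would agree in V and hence in 𝒱, which contradicts their leading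
terms. -/

namespace AOne

noncomputable section

open LaurentPolynomial

/-! ### Roots of Laurent polynomials -/

section Roots

variable {K : Type*} [Field K]

/-- The linear factor `X - z`. -/
def lin (z : Kˣ) : LaurentPolynomial K := T 1 - C (z : K)

/-- Evaluation of Laurent polynomials at a unit. -/
abbrev evalAt (z : Kˣ) : LaurentPolynomial K →+* K := eval₂ (RingHom.id K) z

theorem T_natCast (n : ℕ) : (T (n : ℤ) : LaurentPolynomial K) = T 1 ^ n := by
  rw [T_pow, mul_one]

theorem lin_dvd_T_sub (z : Kˣ) (n : ℤ) : lin z ∣ T n - C ((z ^ n : Kˣ) : K) := by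
  have hnat (m : ℕ) : lin z ∣ T (m : ℤ) - C ((z ^ (m : ℤ) : Kˣ) : K) := by
    rw [T_natCast, zpow_natCast, Units.val_pow_eq_pow_val, map_pow]
    exact sub_dvd_pow_sub_pow _ _ m
  obtain ⟨m, rfl | rfl⟩ := n.eq_nat_or_neg
  · exact hnat m
  · obtain ⟨h, hh⟩ := hnat m
    have e1 := TT (K := K) m
    have e2 := CC (z ^ (m : ℤ))
    refine ⟨-(T (-m) * C (((z ^ (m : ℤ))⁻¹ : Kˣ) : K)) * h, ?_⟩
    rw [zpow_neg]
    linear_combination (-(T (-m) * C (((z ^ (m : ℤ))⁻¹ : Kˣ) : K))) * hh +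
      C (((z ^ (m : ℤ))⁻¹ : Kˣ) : K) * e1 - T (-m) * e2

theorem lin_dvd_sub (z : Kˣ) (f : LaurentPolynomial K) : lin z ∣ f - C (evalAt z f) := by
  induction f using LaurentPolynomial.induction_on' with
  | add p q hp hq =>
    rw [map_add, map_add, add_sub_add_comm]
    exact dvd_add hp hq
  | C_mul_T n a =>
    have := (lin_dvd_T_sub z n).mul_left (C a)
    simpa [mul_sub] using this

theorem evalAt_lin (z w : Kˣ) : evalAt w (lin z) = w - z := by
  simp [lin]

theorem lin_dvd_iff (z : Kˣ) (f : LaurentPolynomial K) : lin z ∣ f ↔ evalAt z f = 0 := by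
  constructor
  · rintro ⟨g, rfl⟩
    rw [map_mul, evalAt_lin, sub_self, zero_mul]
  · intro h
    simpa [h] using lin_dvd_sub z f

theorem isCoprime_lin {z : Kˣ} {f : LaurentPolynomial K} (h : evalAt z f ≠ 0) :
    IsCoprime (lin z) f := by
  obtain ⟨g, hg⟩ := lin_dvd_sub z f
  have e : (C (evalAt z f)⁻¹ : LaurentPolynomial K) * C (evalAt z f) = 1 := by
    rw [← map_mul, inv_mul_cancel₀ h, map_one]
  exact ⟨-C (evalAt z f)⁻¹ * g, C (evalAt z f)⁻¹, by
    linear_combination C (evalAt z f)⁻¹ * hg + e⟩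

theorem lin_ne_zero (z : Kˣ) : lin z ≠ 0 := by
  intro h
  have h1 := congrArg (fun p : LaurentPolynomial K => p.coeff 1) (sub_eq_zero.mp h)
  simp [C_apply, T_apply] at h1

theorem invert_lin (z : Kˣ) : invert (lin z) = -(C (z : K) * T (-1)) * lin z⁻¹ := by
  have e1 := TT (K := K) 1
  have e2 := CC z
  simp only [lin, map_sub, invert_T, invert_C]
  linear_combination C (z : K) * e1 - T (-1) * e2

/-- Since π is substitution of q^{1/2} X⁻¹ for X, it respects products; this lets it transport
factors, and hence zeros with multiplicity. -/
theorem piOp_mul (v : Kˣ) (f g : LaurentPolynomial K) : piOp v (f * g) = piOp v f * piOp v g := by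
  induction f using LaurentPolynomial.induction_on' with
  | add p q hp hq => rw [add_mul, map_add, map_add, hp, hq, add_mul]
  | C_mul_T n a =>
    have := congrArg (fun A => A g) (piOp_X v n)
    simp only [Module.End.mul_apply, LinearMap.smul_apply, mulX, LinearMap.mulLeft_apply] at this
    rw [mul_assoc, ← smul_eq_C_mul, map_smul, this, ← smul_eq_C_mul, map_smul, piOp, onMonomials_T]
    simp only [smul_eq_C_mul]
    ring

theorem piOp_C (v : Kˣ) (a : K) : piOp v (C a) = C a := by
  rw [show (C a : LaurentPolynomial K) = a • T 0 by rw [smul_eq_C_mul, T_zero, mul_one], map_smul,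
    piOp, onMonomials_T]
  simp

theorem piOp_T (v : Kˣ) (n : ℤ) : piOp v (T n) = C ((v ^ n : Kˣ) : K) * T (-n) := by
  rw [piOp, onMonomials_T]

theorem piOp_dvd (v : Kˣ) {f g : LaurentPolynomial K} (h : f ∣ g) : piOp v f ∣ piOp v g := by
  obtain ⟨h, rfl⟩ := h
  exact ⟨_, piOp_mul v f h⟩

theorem piOp_pow (v : Kˣ) (f : LaurentPolynomial K) (n : ℕ) : piOp v (f ^ n) = piOp v f ^ n := by
  induction n with
  | zero => rw [pow_zero, pow_zero, ← map_one (C (R := K)), piOp_C]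
  | succ n ih => rw [pow_succ, piOp_mul, ih, pow_succ]

theorem piOp_lin (v z : Kˣ) : piOp v (lin z) = -(C (z : K) * T (-1)) * lin (v * z⁻¹) := by
  have e1 := TT (K := K) 1
  have e2 := CC z
  simp only [lin, map_sub, piOp_T, piOp_C, zpow_one, Units.val_mul, map_mul]
  linear_combination C (z : K) * e1 - T (-1) * C (v : K) * e2

theorem lin_pow_dvd_invert {z : Kˣ} {n : ℕ} {f : LaurentPolynomial K} (h : lin z ^ n ∣ f) :
    lin z⁻¹ ^ n ∣ invert f := by
  have h1 := map_dvd (invert (R := K)) h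
  rw [map_pow, invert_lin] at h1
  exact (pow_dvd_pow_of_dvd (dvd_mul_left _ _) n).trans h1

theorem lin_pow_dvd_piOp (v : Kˣ) {z : Kˣ} {n : ℕ} {f : LaurentPolynomial K} (h : lin z ^ n ∣ f) :
    lin (v * z⁻¹) ^ n ∣ piOp v f := by
  have h1 := piOp_dvd v h
  rw [piOp_pow, piOp_lin] at h1
  exact (pow_dvd_pow_of_dvd (dvd_mul_left _ _) n).trans h1

theorem piOp_piOp_apply (v : Kˣ) (f : LaurentPolynomial K) : piOp v (piOp v f) = f :=
  congrArg (fun A : Module.End K (LaurentPolynomial K) => A f) (piOp_piOp v)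

theorem lin_pow_dvd_of_piOp (v : Kˣ) {z : Kˣ} {n : ℕ} {f : LaurentPolynomial K}
    (h : lin z ^ n ∣ piOp v f) : lin (v * z⁻¹) ^ n ∣ f := by
  simpa only [piOp_piOp_apply] using lin_pow_dvd_piOp v h

theorem lin_pow_dvd_of_invert {z : Kˣ} {n : ℕ} {f : LaurentPolynomial K}
    (h : lin z ^ n ∣ invert f) : lin z⁻¹ ^ n ∣ f := by
  have := lin_pow_dvd_invert h
  rwa [show invert (invert f) = f from involutive_invert f] at this

theorem evalAt_invert (z : Kˣ) (f : LaurentPolynomial K) :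
    evalAt z (invert f) = evalAt z⁻¹ f := by
  induction f using LaurentPolynomial.induction_on' with
  | add p q hp hq => rw [map_add, map_add, map_add, hp, hq]
  | C_mul_T n a => simp

/-- The denominator-free form of T₁. All statements about zeros of T₁ f are read off from it. -/
theorem hecke_mul (u : Kˣ) (f : LaurentPolynomial K) :
    (T 2 - 1) * heckeOp u f = (C (u : K) * T 2 - C ((u⁻¹ : Kˣ) : K)) * invert f -
      (C (u : K) - C ((u⁻¹ : Kˣ) : K)) * f := by
  rw [heckeOp_apply]
  linear_combination (C (u : K) - C ((u⁻¹ : Kˣ) : K)) * divDiff_spec f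

/-- Away from the zeros of `u X² - u⁻¹`, divisibility passes from `f` and `T₁ f` to `f(X⁻¹)`. -/
theorem lin_pow_dvd_invert_of_hecke {u z : Kˣ} (hz : z ^ 2 ≠ (u ^ 2)⁻¹) {n : ℕ}
    {f : LaurentPolynomial K} (h : lin z ^ n ∣ f) (h1 : lin z ^ n ∣ heckeOp u f) :
    lin z⁻¹ ^ n ∣ f := by
  apply lin_pow_dvd_of_invert
  have hc : IsCoprime (lin z ^ n) (C (u : K) * T 2 - C ((u⁻¹ : Kˣ) : K)) := by
    refine (isCoprime_lin fun h0 => hz ?_).pow_left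
    rw [map_sub, map_mul, eval₂_C, eval₂_C, eval₂_T, sub_eq_zero] at h0
    have h0' : u * z ^ (2 : ℤ) = u⁻¹ := Units.ext (by simpa using h0)
    rw [eq_inv_iff_mul_eq_one, show z ^ 2 * u ^ 2 = (u * z ^ (2 : ℤ)) * u by
      rw [zpow_ofNat]; simp only [sq, mul_left_comm, mul_comm], h0', inv_mul_cancel]
  apply hc.dvd_of_dvd_mul_left
  have := dvd_add (h1.mul_left (T 2 - 1)) (h.mul_left (C (u : K) - C ((u⁻¹ : Kˣ) : K)))
  rwa [hecke_mul, sub_add_cancel] at this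

theorem special_factor {u z : Kˣ} (hz : z ^ 2 = (u ^ 2)⁻¹) :
    C (u : K) * T 2 - C ((u⁻¹ : Kˣ) : K) = lin z * (C (u : K) * (T 1 + C (z : K))) := by
  have e2 : (T 2 : LaurentPolynomial K) = T 1 * T 1 := by rw [← T_add]; rfl
  have e : (C ((u⁻¹ : Kˣ) : K) : LaurentPolynomial K) = C (u : K) * (C (z : K) * C (z : K)) := by
    rw [← map_mul, ← map_mul, ← Units.val_mul, ← Units.val_mul, ← sq, hz]
    congr 2
    rw [sq, mul_inv, mul_inv_cancel_left]
  rw [e2, e, lin]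
  ring

/-- Here z is itself a zero of u X² - u⁻¹. That zero is simple, the other one being -z ≠ z, so
exactly one order must be given up. -/
theorem lin_pow_dvd_invert_of_hecke_special [CharZero K] {u z : Kˣ} (hz : z ^ 2 = (u ^ 2)⁻¹) {n : ℕ}
    {f : LaurentPolynomial K} (h : lin z ^ (n + 1) ∣ f) (h1 : lin z ^ (n + 1) ∣ heckeOp u f) :
    lin z⁻¹ ^ n ∣ f := by
  apply lin_pow_dvd_of_invert
  have hc : IsCoprime (lin z ^ n) (C (u : K) * (T 1 + C (z : K))) := by
    refine (isCoprime_lin ?_).pow_left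
    simp [← two_mul]
  apply hc.dvd_of_dvd_mul_left
  have := dvd_add (h1.mul_left (T 2 - 1)) (h.mul_left (C (u : K) - C ((u⁻¹ : Kˣ) : K)))
  rw [hecke_mul, sub_add_cancel, special_factor hz, pow_succ', mul_assoc] at this
  exact (mul_dvd_mul_iff_left (lin_ne_zero z)).mp this

theorem T_two_sub_one_factor {z : Kˣ} (hz : z ^ 2 = 1) :
    (T 2 : LaurentPolynomial K) - 1 = lin z * (T 1 + C (z : K)) := by
  have e2 : (T 2 : LaurentPolynomial K) = T 1 * T 1 := by rw [← T_add]; rfl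
  have e : (C (z : K) : LaurentPolynomial K) * C (z : K) = 1 := by
    rw [← map_mul, ← Units.val_mul, ← sq, hz, Units.val_one, map_one]
  rw [e2, lin]
  linear_combination e

theorem inv_of_sq {z : Kˣ} (hz : z ^ 2 = 1) : z⁻¹ = z := by
  rw [inv_eq_iff_mul_eq_one, ← sq, hz]

/-- At a fixed point of `X ↦ X⁻¹`, a simple zero of `f` and `T₁ f` is a double zero of `f`. -/
theorem lin_sq_dvd_of_hecke [CharZero K] {u z : Kˣ} (hu : u ^ 2 ≠ 1) (hz : z ^ 2 = 1)
    {f : LaurentPolynomial K} (h : lin z ∣ f) (h1 : lin z ∣ heckeOp u f) : lin z ^ 2 ∣ f := by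
  obtain ⟨e, rfl⟩ := h
  obtain ⟨g, hg⟩ := h1
  have h2 := hecke_mul u (lin z * e)
  rw [hg, map_mul, invert_lin, inv_of_sq hz, T_two_sub_one_factor hz] at h2
  -- Dividing the identity by X - z and then evaluating at z leaves 2 (u - u⁻¹) e(z) = 0, where e =
  -- f / (X - z).
  have h3 : (T 1 + C (z : K)) * (lin z * g) = (C (u : K) * T 2 - C ((u⁻¹ : Kˣ) : K)) *
      (-(C (z : K) * T (-1)) * invert e) - (C (u : K) - C ((u⁻¹ : Kˣ) : K)) * e := by
    apply mul_left_cancel₀ (lin_ne_zero z)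
    linear_combination h2
  have h4 := congrArg (evalAt z) h3
  have hz' : (z : K) ^ 2 = 1 := by rw [← Units.val_pow_eq_pow_val, hz, Units.val_one]
  have hz'' : (z : K) * (z : K)⁻¹ = 1 := mul_inv_cancel₀ z.ne_zero
  have hu' : (u : K) - (u : K)⁻¹ ≠ 0 := by
    intro h0
    apply hu
    ext
    rw [Units.val_pow_eq_pow_val, sq, Units.val_one]
    nth_rw 2 [sub_eq_zero.mp h0]
    exact mul_inv_cancel₀ u.ne_zero
  simp only [map_mul, map_sub, map_add, map_neg, evalAt_lin, evalAt_invert, inv_of_sq hz, eval₂_C,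
    eval₂_T, sub_self, zero_mul, mul_zero, RingHom.id_apply, zpow_ofNat, zpow_neg,
    Units.val_pow_eq_pow_val, Units.val_inv_eq_inv_val] at h4
  rw [hz', mul_one, pow_one, hz''] at h4
  have h5 : 2 * ((u : K) - (u : K)⁻¹) * evalAt z e = 0 := by linear_combination h4
  rw [sq]
  refine mul_dvd_mul_left _ ((lin_dvd_iff z e).mpr ?_)
  rcases mul_eq_zero.mp h5 with h | h
  · exact absurd h (mul_ne_zero two_ne_zero hu')
  · exact h

theorem lin_pow_dvd_of_two_sub_one {z : Kˣ} (hz : z ^ 2 ≠ 1) {n : ℕ} {f : LaurentPolynomial K}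
    (h : lin z ^ n ∣ (T 2 - 1) * f) : lin z ^ n ∣ f := by
  have hc : IsCoprime (lin z ^ n) ((T 2 : LaurentPolynomial K) - 1) := by
    refine (isCoprime_lin fun h0 => hz ?_).pow_left
    rw [map_sub, map_one, eval₂_T, sub_eq_zero] at h0
    exact Units.ext (by simpa using h0)
  exact hc.dvd_of_dvd_mul_left h

theorem lin_pow_dvd_hecke {u z : Kˣ} (hz : z ^ 2 ≠ 1) {n : ℕ}
    {f : LaurentPolynomial K} (h : lin z ^ n ∣ f) (h1 : lin z⁻¹ ^ n ∣ f) :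
    lin z ^ n ∣ heckeOp u f := by
  apply lin_pow_dvd_of_two_sub_one hz
  rw [hecke_mul]
  have := lin_pow_dvd_invert h1
  rw [inv_inv] at this
  exact dvd_sub (this.mul_left _) (h.mul_left _)

/-- The zero of u X² - u⁻¹ at z supplies the order that f(X⁻¹) may lack. -/
theorem lin_pow_dvd_hecke_special {u z : Kˣ} (hz1 : z ^ 2 ≠ 1) (hz : z ^ 2 = (u ^ 2)⁻¹) {n : ℕ}
    {f : LaurentPolynomial K} (h : lin z ^ (n + 1) ∣ f) (h1 : lin z⁻¹ ^ n ∣ f) :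
    lin z ^ (n + 1) ∣ heckeOp u f := by
  apply lin_pow_dvd_of_two_sub_one hz1
  rw [hecke_mul, special_factor hz]
  have := lin_pow_dvd_invert h1
  rw [inv_inv] at this
  refine dvd_sub ?_ (h.mul_left _)
  rw [pow_succ', mul_assoc]
  exact mul_dvd_mul_left _ (this.mul_left _)

/-- Division by X² - 1 threatens to cost one order at z = ±1. It does not: after removing (X - z)²
the two terms of the numerator cancel at z. -/
theorem lin_sq_dvd_hecke [CharZero K] {u z : Kˣ} (hz : z ^ 2 = 1)
    {f : LaurentPolynomial K} (h : lin z ^ 2 ∣ f) : lin z ^ 2 ∣ heckeOp u f := by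
  obtain ⟨e, rfl⟩ := h
  have h2 := hecke_mul u (lin z ^ 2 * e)
  rw [map_mul (invert (R := K)), map_pow (invert (R := K)), invert_lin, inv_of_sq hz,
    T_two_sub_one_factor hz] at h2
  have hz' : (z : K) ^ 2 = 1 := by rw [← Units.val_pow_eq_pow_val, hz, Units.val_one]
  have hz'' : (z : K) * (z : K)⁻¹ = 1 := mul_inv_cancel₀ z.ne_zero
  have h3 : lin z ∣ (C (u : K) * T 2 - C ((u⁻¹ : Kˣ) : K)) *
      ((C (z : K) * T (-1)) ^ 2 * invert e) - (C (u : K) - C ((u⁻¹ : Kˣ) : K)) * e := by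
    rw [lin_dvd_iff]
    simp only [map_mul, map_sub, map_pow, evalAt_invert, inv_of_sq hz, eval₂_C,
      eval₂_T, RingHom.id_apply, zpow_ofNat, zpow_neg,
      Units.val_pow_eq_pow_val, Units.val_inv_eq_inv_val]
    rw [hz', mul_one, pow_one, hz'']
    ring
  obtain ⟨g, hg⟩ := h3
  have h4 : (T 1 + C (z : K)) * heckeOp u (lin z ^ 2 * e) = lin z ^ 2 * g := by
    apply mul_left_cancel₀ (lin_ne_zero z)
    linear_combination h2 + lin z ^ 2 * hg
  have hc : IsCoprime (lin z ^ 2) (T 1 + C (z : K)) := by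
    refine (isCoprime_lin ?_).pow_left
    simp [← two_mul]
  exact hc.dvd_of_dvd_mul_left (Dvd.intro _ h4.symm)

end Roots

/-! ### The ideal of the radical -/

section Ideal

variable {K : Type*} [Field K]

theorem zpow_eq_iff {v : Kˣ} {N : ℕ} (hv : IsPrimitiveRoot v (2 * N)) (i j : ℤ) :
    v ^ i = v ^ j ↔ (2 * N : ℤ) ∣ i - j := by
  rw [← div_eq_one, div_eq_mul_inv, ← zpow_sub, hv.zpow_eq_one_iff_dvd]
  push_cast
  rfl

/-- Locates the exceptional points z² = t⁻¹ of T₁ among the powers of v. -/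
theorem sq_eq_iff {v : Kˣ} {N : ℕ} (hv : IsPrimitiveRoot v (2 * N)) (j a : ℤ) :
    (v ^ j) ^ 2 = ((v ^ (-a)) ^ 2)⁻¹ ↔ (N : ℤ) ∣ j - a := by
  rw [← zpow_natCast, ← zpow_natCast, ← zpow_mul, ← zpow_mul, ← zpow_neg, zpow_eq_iff hv]
  rw [show j * (2 : ℕ) - -(-a * (2 : ℕ)) = 2 * (j - a) by push_cast; ring]
  exact mul_dvd_mul_iff_left two_ne_zero

theorem eq_zero_of_dvd_of_abs_lt {n d : ℤ} (h : n ∣ d) (h1 : -n < d) (h2 : d < n) : d = 0 := by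
  apply Int.eq_zero_of_abs_lt_dvd h
  rw [abs_lt]
  exact ⟨h1, h2⟩

theorem cases_of_dvd {n d : ℤ} (h : n ∣ d) (h1 : -(2 * n) < d) (h2 : d < 2 * n) :
    d = 0 ∨ d = n ∨ d = -n := by
  rcases lt_trichotomy d 0 with h0 | h0 | h0
  · right; right
    have := eq_zero_of_dvd_of_abs_lt ((dvd_add_self_right).mpr h) (by omega) (by omega)
    omega
  · exact Or.inl h0
  · right; left
    have := eq_zero_of_dvd_of_abs_lt ((dvd_sub_self_right).mpr h) (by omega) (by omega)
    omega

/-- The exponents of the double roots. -/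
def doubleRoots (N a : ℤ) : Finset ℤ :=
  Finset.Icc (1 - a) a ∪ Finset.Icc (N - a + 1) N ∪ Finset.Icc (1 - N) (a - N)

/-- The multiplicity of the root `v ^ j`. -/
def rootMult (N a j : ℤ) : ℕ := if j ∈ doubleRoots N a then 2 else 1

/-- The generator of the radical. -/
def genPoly (v : Kˣ) (N a : ℤ) : Polynomial K :=
  ∏ j ∈ Finset.Icc (1 - N) N, (Polynomial.X - Polynomial.C ((v ^ j : Kˣ) : K)) ^ rootMult N a j

theorem toLaurent_genPoly (v : Kˣ) (N a : ℤ) :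
    (genPoly v N a).toLaurent = ∏ j ∈ Finset.Icc (1 - N) N, lin (v ^ j) ^ rootMult N a j := by
  simp [genPoly, lin]

theorem mem_doubleRoots {N a j : ℤ} : j ∈ doubleRoots N a ↔
    (1 - a ≤ j ∧ j ≤ a) ∨ (N - a + 1 ≤ j ∧ j ≤ N) ∨ (1 - N ≤ j ∧ j ≤ a - N) := by
  simp [doubleRoots]

theorem rootMult_le {N a j i : ℤ} (h : j ∈ doubleRoots N a → i ∈ doubleRoots N a) :
    rootMult N a j ≤ rootMult N a i := by
  unfold rootMult
  split_ifs with h1 h2 <;> first | omega | exact absurd (h h1) h2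

variable {v : Kˣ} {N : ℕ} {a : ℤ}

/-- The exponents run over 2N consecutive integers, so the roots v^j are distinct and the factors
are pairwise coprime. -/
theorem genPoly_dvd_iff (hv : IsPrimitiveRoot v (2 * N)) (f : LaurentPolynomial K) :
    (genPoly v N a).toLaurent ∣ f ↔
      ∀ j ∈ Finset.Icc (1 - (N : ℤ)) N, lin (v ^ j) ^ rootMult N a j ∣ f := by
  rw [toLaurent_genPoly]
  constructor
  · intro h j hj
    exact (Finset.dvd_prod_of_mem (fun i => lin (v ^ i) ^ rootMult N a i) hj).trans h
  · intro h
    refine Finset.prod_dvd_of_coprime ?_ h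
    intro i hi j hj hij
    have hc : IsCoprime (lin (v ^ i)) (lin (v ^ j)) := by
      apply isCoprime_lin
      intro h0
      rw [evalAt_lin, sub_eq_zero] at h0
      have := (zpow_eq_iff hv _ _).mp (Units.ext h0)
      simp only [Finset.coe_Icc, Set.mem_Icc] at hi hj
      have := eq_zero_of_dvd_of_abs_lt this (by omega) (by omega)
      omega
    exact hc.pow

/-- The reflection j ↦ 1 - j preserves both the range of exponents and the set of double ones. -/
theorem genPoly_dvd_piOp (hv : IsPrimitiveRoot v (2 * N)) {f : LaurentPolynomial K}
    (h : (genPoly v N a).toLaurent ∣ f) : (genPoly v N a).toLaurent ∣ piOp v f := by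
  rw [genPoly_dvd_iff hv] at h ⊢
  intro j hj
  rw [Finset.mem_Icc] at hj
  have h1 := lin_pow_dvd_piOp v (h (1 - j) (by rw [Finset.mem_Icc]; omega))
  rw [show v * (v ^ (1 - j))⁻¹ = v ^ j by rw [zpow_sub, zpow_one]; group] at h1
  refine (pow_dvd_pow _ (rootMult_le ?_)).trans h1
  simp only [mem_doubleRoots]
  omega

/-- Under j ↦ -j the set of double exponents is preserved except possibly at j = a and j = a - N.
There the partner may be only a simple zero, and the vanishing of u X² - u⁻¹ makes up for it. The
fixed points ±1 are double zeros and are treated separately. -/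
theorem genPoly_dvd_heckeOp [CharZero K] (hv : IsPrimitiveRoot v (2 * N)) (ha : 0 < a)
    (haN : 2 * a ≤ N) {f : LaurentPolynomial K}
    (h : (genPoly v N a).toLaurent ∣ f) : (genPoly v N a).toLaurent ∣ heckeOp (v ^ (-a)) f := by
  rw [genPoly_dvd_iff hv] at h ⊢
  intro j hj
  have hj' := hj
  rw [Finset.mem_Icc] at hj
  by_cases h1 : (v ^ j) ^ 2 = 1
  · have h2 := h j hj'
    have hd : (N : ℤ) ∣ j - 0 := by
      rw [← sq_eq_iff hv, h1]
      simp
    have : j ∈ doubleRoots N a := by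
      have := cases_of_dvd hd (by omega) (by omega)
      rw [mem_doubleRoots]
      omega
    rw [rootMult, if_pos this] at h2 ⊢
    exact lin_sq_dvd_hecke h1 h2
  · have hj0 : j ≠ N := by
      rintro rfl
      refine h1 ?_
      rw [← zpow_natCast, ← zpow_mul, hv.zpow_eq_one_iff_dvd]
      push_cast
      rw [mul_comm]
    have h2 := h (-j) (by rw [Finset.mem_Icc]; omega)
    rw [zpow_neg] at h2
    by_cases hs : j = a ∨ j = a - N
    · have hs' : (v ^ j) ^ 2 = ((v ^ (-a)) ^ 2)⁻¹ := by
        rw [sq_eq_iff hv]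
        rcases hs with rfl | rfl <;> simp
      have hm : rootMult N a j = 1 + 1 := by
        rw [rootMult, if_pos]
        rw [mem_doubleRoots]
        omega
      have h3 := h j hj'
      rw [hm] at h3 ⊢
      refine lin_pow_dvd_hecke_special h1 hs' h3 ((pow_dvd_pow _ ?_).trans h2)
      rw [rootMult]
      split_ifs <;> norm_num
    · refine lin_pow_dvd_hecke h1 (h j hj') ((pow_dvd_pow _ (rootMult_le ?_)).trans h2)
      simp only [mem_doubleRoots]
      omega

theorem int_induction_up {Q : ℤ → Prop} {b c : ℤ} (hb : Q b)
    (hs : ∀ j, b ≤ j → j < c → Q j → Q (j + 1)) (j : ℤ) (h1 : b ≤ j) (h2 : j ≤ c) : Q j := by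
  induction j, h1 using Int.leInduction with
  | base => exact hb
  | succ n hn ih => exact hs n hn (by omega) (ih (by omega))

theorem int_induction_down {Q : ℤ → Prop} {b c : ℤ} (hc : Q c)
    (hs : ∀ j, b ≤ j → j < c → Q (j + 1) → Q j) (j : ℤ) (h1 : b ≤ j) (h2 : j ≤ c) : Q j := by
  induction j, h2 using Int.leInductionDown with
  | base => exact hc
  | pred n hn ih =>
    exact hs (n - 1) h1 (by omega) (by rw [sub_add_cancel]; exact ih (by omega))

theorem not_dvd_of_lt {n d : ℤ} (h : 0 < d ∧ d < n ∨ -n < d ∧ d < 0 ∨ -(2 * n) < d ∧ d < -n) :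
    ¬ n ∣ d := by
  intro hd
  have := cases_of_dvd hd (by omega) (by omega)
  omega

/-- A proper ideal that contains the generator and is stable under the operators is the ideal of
the generator. -/
theorem genPoly_dvd_of_mem [CharZero K] (hv : IsPrimitiveRoot v (2 * N)) (ha : 0 < a)
    (haN : 2 * a ≤ N) {J : Ideal (LaurentPolynomial K)}
    (hT : ∀ f ∈ J, heckeOp (v ^ (-a)) f ∈ J) (hpi : ∀ f ∈ J, piOp v f ∈ J)
    (hG : (genPoly v N a).toLaurent ∈ J) (hJ : J ≠ ⊤) {f : LaurentPolynomial K} (hf : f ∈ J) :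
    (genPoly v N a).toLaurent ∣ f := by
  -- Common zeros of J travel: π sends j to 1 - j and T₁ sends j to -j, so together they shift j by
  -- one, except across the exceptional points.
  let P (i : ℕ) (j : ℤ) : Prop := ∀ f ∈ J, lin (v ^ j) ^ i ∣ f
  have pP {i j} (h : P i j) : P i (1 - j) := fun f hf => by
    have := lin_pow_dvd_of_piOp v (h _ (hpi f hf))
    rwa [show v * (v ^ j)⁻¹ = v ^ (1 - j) by rw [zpow_sub, zpow_one]] at this
  have pT {i j} (hj : ¬ (N : ℤ) ∣ j - a) (h : P i j) : P i (-j) := fun f hf => by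
    have := lin_pow_dvd_invert_of_hecke (mt (sq_eq_iff hv j a).mp hj) (h f hf) (h _ (hT f hf))
    rwa [← zpow_neg] at this
  have pS {i j} (hj : (N : ℤ) ∣ j - a) (h : P (i + 1) j) : P i (-j) := fun f hf => by
    have := lin_pow_dvd_invert_of_hecke_special ((sq_eq_iff hv j a).mpr hj) (h f hf) (h _ (hT f hf))
    rwa [← zpow_neg] at this
  have pE {j} (hj : (v ^ j) ^ 2 = 1) (h : P 1 j) : P 2 j := fun f hf => by
    refine lin_sq_dvd_of_hecke (u := v ^ (-a)) ?_ hj (by simpa using h f hf)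
      (by simpa using h _ (hT f hf))
    intro h1
    have : (N : ℤ) ∣ 0 - a := by rw [← sq_eq_iff hv, h1]; simp
    exact not_dvd_of_lt (by omega) this
  -- Going up is j ↦ -j ↦ j + 1, blocked when j ≡ a; going down is j + 1 ↦ -j ↦ j, blocked when j ≡
  -- -a modulo N.
  have pU {i j} (hj : ¬ (N : ℤ) ∣ j - a) (h : P i j) : P i (j + 1) := by
    have := pP (pT hj h)
    rwa [sub_neg_eq_add, add_comm] at this
  have pD {i j} (hj : ¬ (N : ℤ) ∣ -j - a) (h : P i (j + 1)) : P i j := by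
    have := pT (j := -j) hj (by have := pP h; rwa [show 1 - (j + 1) = -j by ring] at this)
    rwa [neg_neg] at this
  have p0 : P 1 0 → P 2 0 := pE (by simp)
  have pN : P 1 N → P 2 N :=
    pE (by rw [← zpow_natCast, ← zpow_mul, hv.zpow_eq_one_iff_dvd]; push_cast; rw [mul_comm])
  have pNdown (h : P 1 N) : ∀ j : ℤ, N - a + 1 ≤ j → j ≤ N → P 2 j :=
    int_induction_down (pN h) fun j h1 h2 => pD (not_dvd_of_lt (by omega))
  -- A maximal ideal over J contains G, hence one of its linear factors. An f in J not vanishing at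
  -- the root of that factor would be coprime to it.
  have start : ∃ j ∈ Finset.Icc (1 - (N : ℤ)) N, P 1 j := by
    obtain ⟨m, hm, hJm⟩ := Ideal.exists_le_maximal J hJ
    have hGm := hJm hG
    rw [toLaurent_genPoly, hm.isPrime.prod_mem_iff] at hGm
    obtain ⟨j, hj, h⟩ := hGm
    refine ⟨j, hj, fun f hf => ?_⟩
    have h1 := hm.isPrime.mem_of_pow_mem _ h
    rw [pow_one, lin_dvd_iff]
    by_contra h0
    obtain ⟨x, y, hxy⟩ := isCoprime_lin h0
    exact hm.ne_top ((Ideal.eq_top_iff_one _).mpr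
      (hxy ▸ m.add_mem (m.mul_mem_left _ h1) (m.mul_mem_left _ (hJm hf))))
  have low (n : ℤ) (hn : 0 ≤ n) (hn' : n ≤ N - a) (h : P 1 n) : P 1 0 :=
    int_induction_down (b := 0) h (fun j h1 h2 => pD (not_dvd_of_lt (by omega))) 0 le_rfl hn
  have zero : P 1 0 := by
    have : ∃ n : ℤ, 0 ≤ n ∧ n ≤ N ∧ P 1 n := by
      obtain ⟨j, hj, h⟩ := start
      rw [Finset.mem_Icc] at hj
      by_cases h0 : 0 ≤ j
      · exact ⟨j, h0, hj.2, h⟩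
      · exact ⟨1 - j, by omega, by omega, pP h⟩
    obtain ⟨n, h0, h1, h⟩ := this
    by_cases hn : n ≤ N - a
    · exact low n h0 hn h
    -- Above N - a the way down is blocked. Instead climb to N, where the zero doubles, descend with
    -- order two to N - a + 1, reflect by π to a - N, and cross this exceptional point, which leaves
    -- a simple zero at N - a.
    · have hN : P 1 N :=
        int_induction_up (c := N) h (fun j h1 h2 => pU (not_dvd_of_lt (by omega))) N h1 le_rfl
      have h2 := pP (pNdown hN (N - a + 1) le_rfl (by omega))
      have h3 := pS (i := 1) (by simp) h2
      exact low (N - a) (by omega) le_rfl (by convert h3 using 1; ring)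
  have up2 : ∀ j : ℤ, 0 ≤ j → j ≤ a → P 2 j :=
    int_induction_up (p0 zero) fun j h1 h2 => pU (not_dvd_of_lt (by omega))
  have weak {j : ℤ} (h : P 2 j) : P 1 j := fun f hf => (pow_dvd_pow _ one_le_two).trans (h f hf)
  -- Crossing j = a costs one of the two orders; the second is recovered only at N, from where it
  -- descends to N - a + 1.
  have up1 : ∀ j : ℤ, a + 1 ≤ j → j ≤ N → P 1 j := by
    refine int_induction_up ?_ fun j h1 h2 => pU (not_dvd_of_lt (by omega))
    have := pP (pS (i := 1) (by simp) (up2 a ha.le le_rfl))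
    rwa [sub_neg_eq_add, add_comm] at this
  have all1 (j : ℤ) (h1 : 0 ≤ j) (h2 : j ≤ N) : P 1 j := by
    by_cases h : j ≤ a
    · exact weak (up2 j h1 h)
    · exact up1 j (by omega) h2
  have hN2 := pNdown (all1 N (by omega) le_rfl)
  have main (j : ℤ) (h1 : 0 ≤ j) (h2 : j ≤ N) : P (rootMult N a j) j := by
    rw [rootMult]
    split_ifs with h
    · rw [mem_doubleRoots] at h
      by_cases h3 : j ≤ a
      · exact up2 j h1 h3
      · exact hN2 j (by omega) h2
    · exact all1 j h1 h2
  rw [genPoly_dvd_iff hv]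
  intro j hj
  rw [Finset.mem_Icc] at hj
  by_cases h0 : 0 ≤ j
  · exact main j h0 hj.2 f hf
  · have h1 := pP (main (1 - j) (by omega) (by omega)) f hf
    rw [sub_sub_cancel] at h1
    refine (pow_dvd_pow _ (rootMult_le ?_)).trans h1
    simp only [mem_doubleRoots]
    omega

end Ideal

/-! ### Adjointness of the pairing -/

section Pairing

variable {K : Type*} [Field K] {v u : Kˣ}

theorem DAHA.induction {motive : DAHA K v u → Prop}
    (algebraMap : ∀ c : K, motive (algebraMap K _ c)) (ofGen : ∀ g, motive (ofGen K v u g))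
    (mul : ∀ a b, motive a → motive b → motive (a * b))
    (add : ∀ a b, motive a → motive b → motive (a + b)) (h : DAHA K v u) : motive h := by
  obtain ⟨x, rfl⟩ := RingQuot.mkAlgHom_surjective K (Rel K v u) h
  induction x using FreeAlgebra.induction with
  | grade0 r => rw [AlgHom.commutes]; exact algebraMap r
  | grade1 g => exact ofGen g
  | mul a b ha hb => rw [map_mul]; exact mul _ _ ha hb
  | add a b ha hb => rw [map_add]; exact add _ _ ha hb

variable (K v u)

theorem X_mul_Xinv : ofGen K v u .X * ofGen K v u .Xinv = 1 := by
  simpa [ofGen] using RingQuot.mkAlgHom_rel K (Rel.X_mul_Xinv (K := K) (v := v) (u := u))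

theorem Xinv_mul_X : ofGen K v u .Xinv * ofGen K v u .X = 1 := by
  simpa [ofGen] using RingQuot.mkAlgHom_rel K (Rel.Xinv_mul_X (K := K) (v := v) (u := u))

theorem T1_X_T1 : ofGen K v u .T1 * ofGen K v u .X * ofGen K v u .T1 = ofGen K v u .Xinv := by
  simpa [ofGen] using RingQuot.mkAlgHom_rel K (Rel.T1_X_T1 (K := K) (v := v) (u := u))

theorem T0_eq : ofGen K v u .T0 = ofGen K v u .pi * ofGen K v u .T1 * ofGen K v u .pi := by
  have h : ofGen K v u .pi * ofGen K v u .T1 = ofGen K v u .T0 * ofGen K v u .pi := by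
    simpa [ofGen] using RingQuot.mkAlgHom_rel K (Rel.pi_T1 (K := K) (v := v) (u := u))
  rw [h, mul_assoc, pi_mul_pi, mul_one]

theorem pi_X : ofGen K v u .pi * ofGen K v u .X =
    (v : K) • (ofGen K v u .Xinv * ofGen K v u .pi) := by
  have h := RingQuot.mkAlgHom_rel K (Rel.pi_X (K := K) (v := v) (u := u))
  rw [Algebra.smul_def]
  simpa only [ofGen, map_mul, AlgHom.commutes, scal, mul_assoc] using h

theorem T1inv_Xinv_T1inv : T1inv K v u * ofGen K v u .Xinv * T1inv K v u = ofGen K v u .X := by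
  rw [← T1_X_T1, mul_assoc, mul_assoc, mul_assoc, T1_mul_T1inv, mul_one, ← mul_assoc,
    T1inv_mul_T1, one_mul]

theorem T1_Yinv_T1 : ofGen K v u .T1 * ((Y K v u)⁻¹ : (DAHA K v u)ˣ) * ofGen K v u .T1 =
    Y K v u := by
  change ofGen K v u .T1 * (T1inv K v u * ofGen K v u .pi) * ofGen K v u .T1 =
    ofGen K v u .pi * ofGen K v u .T1
  rw [← mul_assoc, T1_mul_T1inv, one_mul]

theorem T1inv_eq : T1inv K v u = ofGen K v u .T1 - ((u : K) - ((u⁻¹ : Kˣ) : K)) • 1 := by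
  rw [T1inv, Algebra.algebraMap_eq_smul_one]

/-- The dual intertwiner `T₁⁻¹ X⁻¹` exchanges `v Y` and `Y⁻¹`. -/
theorem semiconj_T1inv_Xinv (n : ℤ) :
    (((Y K v u)⁻¹ ^ n : (DAHA K v u)ˣ) : DAHA K v u) * (T1inv K v u * ofGen K v u .Xinv) =
      ((v ^ n : Kˣ) : K) • (T1inv K v u * ofGen K v u .Xinv * ((Y K v u ^ n : (DAHA K v u)ˣ))) := by
  have hs : SemiconjBy (T1inv K v u * ofGen K v u .Xinv)
      ((Units.map (algebraMap K (DAHA K v u)).toMonoidHom v * Y K v u : (DAHA K v u)ˣ) :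
        DAHA K v u) ((Y K v u)⁻¹ : (DAHA K v u)ˣ) := by
    -- In the form X T₁ the intertwiner can be moved past π with the single relation π X = v X⁻¹ π.
    have e : ofGen K v u .X * ofGen K v u .T1 = T1inv K v u * ofGen K v u .Xinv := by
      rw [← T1_X_T1, ← mul_assoc, ← mul_assoc, T1inv_mul_T1, one_mul]
    change T1inv K v u * ofGen K v u .Xinv *
        (algebraMap K _ (v : K) * (ofGen K v u .pi * ofGen K v u .T1)) =
      T1inv K v u * ofGen K v u .pi * (T1inv K v u * ofGen K v u .Xinv)
    have h := pi_X K v u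
    rw [← e, mul_assoc (T1inv K v u) _ (_ * _), ← mul_assoc (ofGen K v u .pi) (ofGen K v u .X), h,
      ← Algebra.smul_def, mul_smul_comm]
    simp only [mul_assoc, smul_mul_assoc, mul_smul_comm]
    rw [← mul_assoc (ofGen K v u .X), e, mul_assoc]
  have hc : Commute (Units.map (algebraMap K (DAHA K v u)).toMonoidHom v) (Y K v u) :=
    Units.ext (Algebra.commutes _ _)
  have := (hs.units_zpow_right n).eq
  rw [hc.mul_zpow] at this
  rw [← this, ← map_zpow, Units.val_mul, Units.coe_map]
  rw [Algebra.smul_def, ← mul_assoc, ← mul_assoc]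
  congr 1
  exact (Algebra.commutes _ _).symm

/-- A Laurent polynomial as a vector of the polynomial representation. -/
abbrev ofPoly : LaurentPolynomial K ≃ₗ[K] PolyRep K v u := (toPoly K v u).symm

theorem dunkl_T (n : ℤ) :
    dunkl K v u (ofPoly K v u (T n)) = (((Y K v u)⁻¹ ^ n : (DAHA K v u)ˣ) : DAHA K v u) := by
  simp [dunkl, ofPoly, smeval_T_pow]

theorem dunkl_T_mul (n : ℤ) (f : LaurentPolynomial K) :
    dunkl K v u (ofPoly K v u (T n * f)) =
      (((Y K v u)⁻¹ ^ n : (DAHA K v u)ˣ) : DAHA K v u) * dunkl K v u (ofPoly K v u f) := by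
  induction f using LaurentPolynomial.induction_on' with
  | add p q hp hq => simp only [mul_add, map_add, hp, hq]
  | C_mul_T m a =>
    rw [mul_left_comm, ← T_add, ← smul_eq_C_mul, ← smul_eq_C_mul, map_smul, map_smul, map_smul,
      map_smul, dunkl_T, dunkl_T, mul_smul_comm, zpow_add, Units.val_mul]

theorem dunkl_one : dunkl K v u (ofPoly K v u 1) = 1 := by
  rw [← T_zero, dunkl_T, zpow_zero, Units.val_one]

theorem toPoly_X (f : PolyRep K v u) :
    toPoly K v u (ofGen K v u .X • f) = T 1 * toPoly K v u f := toPoly_ofGen_smul K v u _ f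

theorem toPoly_Xinv (f : PolyRep K v u) :
    toPoly K v u (ofGen K v u .Xinv • f) = T (-1) * toPoly K v u f := toPoly_ofGen_smul K v u _ f

theorem toPoly_T1 (f : PolyRep K v u) :
    toPoly K v u (ofGen K v u .T1 • f) = heckeOp u (toPoly K v u f) := toPoly_ofGen_smul K v u _ f

theorem toPoly_pi (f : PolyRep K v u) :
    toPoly K v u (ofGen K v u .pi • f) = piOp v (toPoly K v u f) := toPoly_ofGen_smul K v u _ f

/-- An eigenvector of a unit is an eigenvector of its powers. -/
theorem zpow_smul_eq {M : Type*} [AddCommGroup M] [Module K M] [Module (DAHA K v u) M]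
    [IsScalarTower K (DAHA K v u) M] (h : (DAHA K v u)ˣ) (y : Kˣ) {x : M}
    (hx : (h : DAHA K v u) • x = (y : K) • x) (n : ℤ) :
    ((h ^ n : (DAHA K v u)ˣ) : DAHA K v u) • x = ((y ^ n : Kˣ) : K) • x := by
  induction n using Int.induction_on with
  | zero => simp
  | succ n ih =>
    rw [zpow_add_one, Units.val_mul, mul_smul, hx, smul_comm, ih, smul_smul,
      zpow_add_one, Units.val_mul, mul_comm]
  | pred n ih =>
    have h0 := congrArg (fun x => ((h⁻¹ : (DAHA K v u)ˣ) : DAHA K v u) • x) hx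
    simp only [← mul_smul, Units.inv_mul, one_smul] at h0
    rw [smul_comm] at h0
    have h1 := congrArg (fun x => ((y⁻¹ : Kˣ) : K) • x) h0
    simp only [smul_smul, Units.inv_mul, one_smul] at h1
    rw [zpow_sub_one, Units.val_mul, mul_smul, ← h1, smul_comm, ih, smul_smul,
      zpow_sub_one, Units.val_mul, mul_comm]

theorem divDiff_T_zero : divDiff (T 0 : LaurentPolynomial K) = 0 := by
  rw [divDiff, onMonomials_T]
  simp

/-- The Lusztig relation between `T₁` and `f(Y⁻¹)`. -/
theorem dunkl_mul_T1 (f : LaurentPolynomial K) :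
    dunkl K v u (ofPoly K v u f) * ofGen K v u .T1 =
      ofGen K v u .T1 * dunkl K v u (ofPoly K v u (invert f)) +
        ((u : K) - ((u⁻¹ : Kˣ) : K)) • dunkl K v u (ofPoly K v u (divDiff f)) := by
  set c := (u : K) - ((u⁻¹ : Kˣ) : K) with hc
  set t := ofGen K v u .T1 with ht
  set d : LaurentPolynomial K → DAHA K v u := fun f => dunkl K v u (ofPoly K v u f) with hd
  have dadd (f g) : d (f + g) = d f + d g := by simp [hd]
  have dsub (f g) : d (f - g) = d f - d g := by simp [hd]
  have dsmul (a : K) (f) : d (a • f) = a • d f := by simp [hd]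
  set z : DAHA K v u := (((Y K v u)⁻¹ : (DAHA K v u)ˣ) : DAHA K v u) with hz
  set y : DAHA K v u := (Y K v u : DAHA K v u) with hy
  have dT (f) : d (T 1 * f) = z * d f := by simp only [hd, dunkl_T_mul, hz, zpow_one]
  have dTi (f) : d (T (-1) * f) = y * d f := by
    simp only [hd, dunkl_T_mul, hy, zpow_neg, zpow_one, inv_inv]
  have yz : y * z = 1 := Units.mul_inv _
  have zy : z * y = 1 := Units.inv_mul _
  have tzt : t * z * t = y := T1_Yinv_T1 K v u
  have tinv : T1inv K v u * t = 1 := T1inv_mul_T1 K v u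
  have tinv' : t * T1inv K v u = 1 := T1_mul_T1inv K v u
  have tinve : T1inv K v u = t - c • 1 := T1inv_eq K v u
  -- These are the cases f = X and f = X⁻¹; the other monomials follow by induction in both
  -- directions.
  have zt : z * t = t * y - c • y := by
    calc z * t = T1inv K v u * (t * z * t) := by
          rw [mul_assoc, ← mul_assoc _ t, tinv, one_mul]
      _ = _ := by rw [tzt, tinve, sub_mul, smul_mul_assoc, one_mul]
  have yt : y * t = t * z + c • y := by
    have h1 : t * z = y * T1inv K v u := by rw [← tzt, mul_assoc, tinv', mul_one]
    rw [h1, tinve, mul_sub, mul_smul_comm, mul_one, sub_add_cancel]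
  -- The equation defining the divided difference, evaluated at Y⁻¹. Multiplied by Y it provides the
  -- cancellation in both inductive steps.
  have spec (f) : z * (z * d (divDiff f)) - d (divDiff f) = d (invert f) - d f := by
    rw [← dsub, ← divDiff_spec, sub_mul, one_mul, dsub, ← dT, ← dT, ← mul_assoc, ← T_add]
    rfl
  have spec' (f) : z * d (divDiff f) - y * d (divDiff f) = y * d (invert f) - y * d f := by
    rw [← mul_sub, ← spec, mul_sub, ← mul_assoc y z, yz, one_mul]
  change d f * t = t * d (invert f) + c • d (divDiff f)
  have key (n : ℤ) : d (T n) * t = t * d (invert (T n)) + c • d (divDiff (T n)) := by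
    have d1 : d (T 0) = 1 := by rw [T_zero]; exact dunkl_one K v u
    induction n using Int.induction_on with
    | zero =>
      rw [divDiff_T_zero, invert_T, neg_zero, d1]
      simp [hd]
    | succ n ih =>
      rw [add_comm, T_add, map_mul, invert_T, divDiff_X, dsub, dT, dTi, dTi, dTi, mul_assoc, ih,
        mul_add, mul_smul_comm, ← mul_assoc z, zt, sub_mul, smul_mul_assoc, mul_assoc]
      have := congrArg (fun x => c • x) (spec' (T n))
      simp only [smul_sub] at this ⊢
      rw [← sub_eq_zero] at this ⊢
      rw [← this]
      abel
    | pred n ih =>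
      have hD : divDiff (T (-1) * T (-(n : ℤ)) : LaurentPolynomial K) =
          T 1 * divDiff (T (-(n : ℤ))) + T (-1) * T (-(n : ℤ)) := by
        have h := divDiff_X (T (-1) * T (-(n : ℤ)) : LaurentPolynomial K)
        have e := TT (K := K) 1
        rw [← mul_assoc, e, one_mul] at h
        rw [h]
        linear_combination (-divDiff (T (-1) * T (-(n : ℤ))) + T (-1) * T (-(n : ℤ))) * e
      rw [sub_eq_add_neg, add_comm, T_add, map_mul, invert_T, hD, dadd, neg_neg, dT, dT, dTi,
        mul_assoc, ih, mul_add, mul_smul_comm, ← mul_assoc y, yt, add_mul, smul_mul_assoc,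
        mul_assoc]
      have := congrArg (fun x => c • x) (spec' (T (-(n : ℤ))))
      simp only [smul_sub, smul_add] at this ⊢
      rw [← sub_eq_zero] at this ⊢
      rw [← neg_eq_zero, ← this]
      abel
  induction f using LaurentPolynomial.induction_on' with
  | add p q hp hq =>
    rw [map_add, map_add, dadd, dadd, dadd, add_mul, hp, hq, mul_add, smul_add]
    abel
  | C_mul_T m a =>
    rw [← smul_eq_C_mul, map_smul, map_smul, dsmul, dsmul, dsmul, smul_mul_assoc, key,
      mul_smul_comm, smul_add, smul_comm]

theorem evalRho_apply (f : PolyRep K v u) : evalRho K v u f = evalAt u⁻¹ (toPoly K v u f) := by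
  obtain ⟨f, rfl⟩ := (ofPoly K v u).surjective f
  induction f using LaurentPolynomial.induction_on' with
  | add p q hp hq => simp only [map_add, hp, hq]
  | C_mul_T m a => simp [evalRho, ofPoly]

theorem evalRho_Xinv (f : PolyRep K v u) :
    evalRho K v u (ofGen K v u .Xinv • f) = u * evalRho K v u f := by
  simp only [evalRho_apply, toPoly_Xinv, map_mul, eval₂_T, zpow_neg, zpow_one, inv_inv]

variable {u}

/-- At X = u⁻¹ the coefficient u X² - u⁻¹ of f(X⁻¹) vanishes, so only f(u⁻¹) remains. The condition
u² ≠ 1 keeps X² - 1 nonzero there. -/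
theorem evalRho_T1 (hu : u ^ 2 ≠ 1) (f : PolyRep K v u) :
    evalRho K v u (ofGen K v u .T1 • f) = u * evalRho K v u f := by
  rw [evalRho_apply, evalRho_apply, toPoly_T1]
  have h := congrArg (evalAt u⁻¹) (hecke_mul u (toPoly K v u f))
  have hu0 : (u : K) ≠ 0 := u.ne_zero
  simp only [map_mul, map_sub, map_one, eval₂_T, eval₂_C, RingHom.id_apply, zpow_ofNat,
    Units.val_pow_eq_pow_val, Units.val_inv_eq_inv_val] at h
  have hu' : 1 - (u : K) ^ 2 ≠ 0 := fun h0 => hu (Units.ext (by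
    rw [Units.val_pow_eq_pow_val, Units.val_one]; exact (sub_eq_zero.mp h0).symm))
  apply mul_left_cancel₀ hu'
  field_simp at h
  linear_combination h

theorem evalRho_T1inv (hu : u ^ 2 ≠ 1) (f : PolyRep K v u) :
    evalRho K v u (T1inv K v u • f) = (u⁻¹ : Kˣ) * evalRho K v u f := by
  have h := evalRho_T1 K v hu (T1inv K v u • f)
  rw [← mul_smul, T1_mul_T1inv, one_smul] at h
  rw [h, ← mul_assoc, Units.inv_mul, one_mul]

/-- The Lusztig relation moves T₁ to the left of f(Y⁻¹), where the evaluation turns it into the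
scalar u; what remains is the formula for T₁ f at Y⁻¹. -/
theorem pairing_T1 (hu : u ^ 2 ≠ 1) (f g : PolyRep K v u) :
    pairing K v u (ofGen K v u .T1 • f) g = pairing K v u f (ofGen K v u .T1 • g) := by
  have h1 : dunkl K v u (ofGen K v u .T1 • f) =
      (u : K) • dunkl K v u (ofPoly K v u (invert (toPoly K v u f))) +
        ((u : K) - ((u⁻¹ : Kˣ) : K)) • dunkl K v u (ofPoly K v u (divDiff (toPoly K v u f))) := by
    have : ofGen K v u .T1 • f = ofPoly K v u ((u : K) • invert (toPoly K v u f) +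
        ((u : K) - ((u⁻¹ : Kˣ) : K)) • divDiff (toPoly K v u f)) := by
      apply (toPoly K v u).injective
      rw [toPoly_T1, LinearEquiv.apply_symm_apply]
      rfl
    rw [this, map_add, map_add, map_smul, map_smul, map_smul, map_smul]
  have h2 := dunkl_mul_T1 K v u (toPoly K v u f)
  rw [ofPoly, LinearEquiv.symm_apply_apply] at h2
  rw [pairing_apply, pairing_apply, h1, ← mul_smul, h2, add_smul, add_smul, map_add, map_add,
    mul_smul, evalRho_T1 K v hu, smul_assoc, map_smul, smul_eq_mul]

/-- On f = X^m this is the exchange of Y⁻¹ and v Y by T₁⁻¹ X⁻¹, and the evaluation does not see this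
intertwiner, since the scalars u⁻¹ and u cancel. -/
theorem pairing_pi (hu : u ^ 2 ≠ 1) (f g : PolyRep K v u) :
    pairing K v u (ofGen K v u .pi • f) g =
      pairing K v u f ((T1inv K v u * ofGen K v u .Xinv) • g) := by
  obtain ⟨f, rfl⟩ := (ofPoly K v u).surjective f
  induction f using LaurentPolynomial.induction_on' with
  | add p q hp hq => simp only [map_add, smul_add, LinearMap.add_apply, hp, hq]
  | C_mul_T m a =>
    rw [← smul_eq_C_mul, map_smul (ofPoly K v u), smul_comm _ a (ofPoly K v u _),
      map_smul (pairing K v u), map_smul (pairing K v u),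
      LinearMap.smul_apply, LinearMap.smul_apply]
    congr 1
    have h1 : dunkl K v u (ofGen K v u .pi • ofPoly K v u (T m)) =
        ((v ^ m : Kˣ) : K) • ((Y K v u ^ m : (DAHA K v u)ˣ) : DAHA K v u) := by
      have : ofGen K v u .pi • ofPoly K v u (T m) =
          ofPoly K v u (((v ^ m : Kˣ) : K) • T (-m)) := by
        apply (toPoly K v u).injective
        rw [toPoly_pi, LinearEquiv.apply_symm_apply, LinearEquiv.apply_symm_apply, piOp_T,
          smul_eq_C_mul]
      rw [this, map_smul, map_smul, dunkl_T, inv_zpow, zpow_neg, inv_inv]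
    rw [pairing_apply, pairing_apply, h1, dunkl_T, ← mul_smul, semiconj_T1inv_Xinv, smul_assoc,
      smul_assoc, LinearMap.map_smul (evalRho K v u), LinearMap.map_smul (evalRho K v u), mul_smul,
      mul_smul, evalRho_T1inv K v hu, evalRho_Xinv,
      ← mul_assoc, Units.inv_mul, one_mul]

theorem ofPoly_T_mul (f : LaurentPolynomial K) :
    ofPoly K v u (T 1 * f) = ofGen K v u .X • ofPoly K v u f :=
  (toPoly K v u).injective (by rw [toPoly_X, LinearEquiv.apply_symm_apply,
    LinearEquiv.apply_symm_apply])

theorem pairing_X (f g : PolyRep K v u) :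
    pairing K v u (ofGen K v u .X • f) g =
      pairing K v u f ((((Y K v u)⁻¹ : (DAHA K v u)ˣ) : DAHA K v u) • g) := by
  obtain ⟨f, rfl⟩ := (ofPoly K v u).surjective f
  have hc : dunkl K v u (ofPoly K v u (T 1 * f)) =
      dunkl K v u (ofPoly K v u f) * (((Y K v u)⁻¹ : (DAHA K v u)ˣ) : DAHA K v u) := by
    induction f using LaurentPolynomial.induction_on' with
    | add p q hp hq => simp only [mul_add, map_add, add_mul, hp, hq]
    | C_mul_T m a =>
      rw [mul_left_comm, ← T_add, ← smul_eq_C_mul, ← smul_eq_C_mul, map_smul, map_smul, map_smul,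
        map_smul, dunkl_T, dunkl_T, add_comm, zpow_add, Units.val_mul, zpow_one, smul_mul_assoc]
  rw [← ofPoly_T_mul, pairing_apply, pairing_apply, hc, mul_smul]

theorem pairing_Xinv (f g : PolyRep K v u) :
    pairing K v u (ofGen K v u .Xinv • f) g = pairing K v u f ((Y K v u : DAHA K v u) • g) := by
  have h := pairing_X K v (ofGen K v u .Xinv • f) ((Y K v u : DAHA K v u) • g)
  rwa [← mul_smul, ← mul_smul, X_mul_Xinv, one_smul, Units.inv_mul, one_smul, eq_comm] at h

theorem pairing_T1inv (hu : u ^ 2 ≠ 1) (f g : PolyRep K v u) :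
    pairing K v u (T1inv K v u • f) g = pairing K v u f (T1inv K v u • g) := by
  have h := pairing_T1 K v hu (T1inv K v u • f) (T1inv K v u • g)
  rwa [← mul_smul, ← mul_smul, T1_mul_T1inv, one_smul, one_smul, eq_comm] at h

/-- Adjoints reverse products: Y⁻¹ = T₁⁻¹ π has adjoint T₁⁻¹ X⁻¹ T₁⁻¹ = X. Together with `pairing_X`
this is the duality between X and Y⁻¹. -/
theorem pairing_Yinv (hu : u ^ 2 ≠ 1) (f g : PolyRep K v u) :
    pairing K v u ((((Y K v u)⁻¹ : (DAHA K v u)ˣ) : DAHA K v u) • f) g =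
      pairing K v u f (ofGen K v u .X • g) := by
  change pairing K v u ((T1inv K v u * ofGen K v u .pi) • f) g = _
  rw [mul_smul, pairing_T1inv K v hu, pairing_pi K v hu, ← mul_smul, T1inv_Xinv_T1inv]

theorem pairing_Y (hu : u ^ 2 ≠ 1) (f g : PolyRep K v u) :
    pairing K v u ((Y K v u : DAHA K v u) • f) g = pairing K v u f (ofGen K v u .Xinv • g) := by
  have h := pairing_Yinv K v hu ((Y K v u : DAHA K v u) • f) (ofGen K v u .Xinv • g)
  rwa [← mul_smul, ← mul_smul, X_mul_Xinv, one_smul, Units.inv_mul, one_smul, eq_comm] at h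

theorem T1_smul_one : ofGen K v u .T1 • ofPoly K v u 1 = (u : K) • ofPoly K v u 1 := by
  apply (toPoly K v u).injective
  rw [toPoly_T1, map_smul, LinearEquiv.apply_symm_apply, heckeOp_apply, ← T_zero, divDiff_T_zero]
  simp [smul_eq_C_mul]

theorem pi_smul_one : ofGen K v u .pi • ofPoly K v u 1 = ofPoly K v u 1 := by
  apply (toPoly K v u).injective
  rw [toPoly_pi, LinearEquiv.apply_symm_apply, ← T_zero, piOp_T]
  simp

theorem Y_smul_one : (Y K v u : DAHA K v u) • ofPoly K v u 1 = (u : K) • ofPoly K v u 1 := by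
  change (ofGen K v u .pi * ofGen K v u .T1) • ofPoly K v u 1 = _
  rw [mul_smul, T1_smul_one, smul_comm, pi_smul_one]

theorem evalRho_one : evalRho K v u (ofPoly K v u 1) = 1 := by
  rw [evalRho_apply, LinearEquiv.apply_symm_apply, map_one]

/-- Pairing with a monomial is the evaluation of the corresponding power of `Y⁻¹`. -/
theorem pairing_T (hu : u ^ 2 ≠ 1) (f : PolyRep K v u) (n : ℤ) :
    pairing K v u f (ofPoly K v u (T n)) =
      evalRho K v u ((((Y K v u)⁻¹ ^ n : (DAHA K v u)ˣ) : DAHA K v u) • f) := by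
  induction n using Int.induction_on generalizing f with
  | zero =>
    rw [zpow_zero, Units.val_one, one_smul, T_zero]
    obtain ⟨f, rfl⟩ := (ofPoly K v u).surjective f
    induction f using LaurentPolynomial.induction_on' with
    | add p q hp hq => simp only [map_add, LinearMap.add_apply, hp, hq]
    | C_mul_T m a =>
      rw [← smul_eq_C_mul, map_smul, map_smul, map_smul, LinearMap.smul_apply]
      congr 1
      -- The vector 1 has Y-eigenvalue u, so Y^{-m} acts on it by u^{-m}, which is also the value of
      -- X^m at u⁻¹.
      rw [pairing_apply, dunkl_T, inv_zpow']
      rw [zpow_smul_eq K v u _ u (Y_smul_one K v) (-m), map_smul, evalRho_one, evalRho_apply,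
        LinearEquiv.apply_symm_apply, eval₂_T,
        inv_zpow', smul_eq_mul, mul_one]
  | succ n ih =>
    rw [add_comm, T_add, ofPoly_T_mul, ← pairing_Yinv K v hu, ih, ← mul_smul, ← Units.val_mul,
      add_comm, zpow_add_one]
  | pred n ih =>
    have : ofPoly K v u (T (-(n : ℤ) - 1)) = ofGen K v u .Xinv • ofPoly K v u (T (-(n : ℤ))) := by
      apply (toPoly K v u).injective
      rw [toPoly_Xinv, LinearEquiv.apply_symm_apply, LinearEquiv.apply_symm_apply, ← T_add,
        neg_add_eq_sub]
    rw [this, ← pairing_Y K v hu, ih, ← mul_smul, ← Units.val_mul, zpow_sub_one, inv_inv]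

theorem mem_radical (f : PolyRep K v u) : f ∈ radical K v u ↔ ∀ g, pairing K v u f g = 0 := by
  rw [radical, LinearMap.mem_ker]
  exact ⟨fun h g => by rw [h]; rfl, fun h => LinearMap.ext h⟩

/-- A subspace stable under the generators is stable under the algebra. -/
theorem smul_mem_of_ofGen {M : Type*} [AddCommGroup M] [Module K M] [Module (DAHA K v u) M]
    [IsScalarTower K (DAHA K v u) M] (W : Submodule K M)
    (hW : ∀ g, ∀ f ∈ W, ofGen K v u g • f ∈ W) (h : DAHA K v u) : ∀ f ∈ W, h • f ∈ W := by
  induction h using DAHA.induction with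
  | algebraMap c =>
    intro f hf
    rw [algebraMap_smul]
    exact W.smul_mem c hf
  | mul a b ha hb => intro f hf; rw [mul_smul]; exact ha _ (hb _ hf)
  | add a b ha hb => intro f hf; rw [add_smul]; exact W.add_mem (ha _ hf) (hb _ hf)
  | ofGen g => exact hW g

/-- The radical as a submodule for the double affine Hecke algebra. -/
def radicalSubmodule (hu : u ^ 2 ≠ 1) : Submodule (DAHA K v u) (PolyRep K v u) where
  __ := radical K v u
  smul_mem' h f := by
    refine smul_mem_of_ofGen K v (radical K v u) (fun g f hf => ?_) h f
    rw [mem_radical] at hf ⊢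
    intro g'
    -- Each generator passes to the second argument as its adjoint, where membership in the radical
    -- applies.
    cases g with
    | X => rw [pairing_X]; exact hf _
    | Xinv => rw [pairing_Xinv]; exact hf _
    | T0 =>
      rw [T0_eq, mul_smul, mul_smul, pairing_pi K v hu, pairing_T1 K v hu, pairing_pi K v hu]
      exact hf _
    | T1 => rw [pairing_T1 K v hu]; exact hf _
    | pi => rw [pairing_pi K v hu]; exact hf _

end Pairing

/-! ### Triangularity of `Y` -/

section Triangular

variable {K : Type*} [Field K]

/-- The position of `m` in the sequence `0, 1, -1, 2, -2, …`. -/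
def position (m : ℤ) : ℤ := if 0 < m then 2 * m - 1 else -2 * m

theorem position_injective : Function.Injective position := by
  intro m n h
  unfold position at h
  split_ifs at h <;> omega

/-- Reduces the order to a comparison of integers within a parity class, which makes transitivity
and later case checks linear arithmetic. -/
theorem succeeds_iff {c m : ℤ} :
    Succeeds c m ↔ position c < position m ∧ (2 : ℤ) ∣ m - c := by
  unfold Succeeds position
  rcases abs_cases c with ⟨h1, h2⟩ | ⟨h1, h2⟩ <;> rcases abs_cases m with ⟨h3, h4⟩ | ⟨h3, h4⟩ <;>
    rw [h1, h3] <;> split_ifs <;> omega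

theorem Succeeds.position_lt {c m : ℤ} (h : Succeeds c m) : position c < position m :=
  (succeeds_iff.mp h).1

theorem Succeeds.trans {c d m : ℤ} (h : Succeeds c d) (h' : Succeeds d m) : Succeeds c m := by
  rw [succeeds_iff] at *
  omega

/-- The span of the monomials with exponents in a set. -/
def spanT (s : Set ℤ) : Submodule K (LaurentPolynomial K) := Submodule.span K (T '' s)

theorem mem_spanT {s : Set ℤ} {f : LaurentPolynomial K} :
    f ∈ spanT s ↔ ∀ c, f.coeff c ≠ 0 → c ∈ s := by
  refine ((AddMonoidAlgebra.basis ℤ K).mem_span_image (s := s) (m := f)).trans ?_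
  exact ⟨fun h c hc => h (Finsupp.mem_support_iff.mpr hc),
    fun h c hc => h c (Finsupp.mem_support_iff.mp hc)⟩

theorem T_mem_spanT {s : Set ℤ} {c : ℤ} (hc : c ∈ s) : (T c : LaurentPolynomial K) ∈ spanT s :=
  Submodule.subset_span ⟨c, hc, rfl⟩

theorem spanT_mono {s t : Set ℤ} (h : s ⊆ t) : spanT (K := K) s ≤ spanT t :=
  Submodule.span_mono (Set.image_mono h)

theorem coeff_sub (f g : LaurentPolynomial K) (c : ℤ) : (f - g).coeff c = f.coeff c - g.coeff c :=
  map_sub ((AddMonoidAlgebra.basis ℤ K).coord c) f g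

theorem coeff_smul (a : K) (f : LaurentPolynomial K) (c : ℤ) : (a • f).coeff c = a * f.coeff c :=
  rfl

theorem coeff_T (m c : ℤ) : (T m : LaurentPolynomial K).coeff c = if m = c then 1 else 0 :=
  T_apply c m

/-- The operator of `Y` on Laurent polynomials. -/
def yOp (v u : Kˣ) : Module.End K (LaurentPolynomial K) := piOp v * heckeOp u

theorem yOp_T (v u : Kˣ) (m : ℤ) : yOp v u (T m) =
    (u : K) • piOp v (T (-m)) + ((u : K) - ((u⁻¹ : Kˣ) : K)) • piOp v (divDiff (T m)) := by
  simp [yOp, heckeOp]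

/-- The divided difference of X^m is a string of monomials with step two, which π reflects. For m <
0 the string avoids X^m, leaving the coefficient u; for m > 0 its first term lands on X^m and
changes u to u - (u - u⁻¹) = u⁻¹. -/
theorem yOp_T_sub_mem (v u : Kˣ) (m : ℤ) :
    yOp v u (T m) - (qWeight v u m : K) • T m ∈ spanT {c | Succeeds c m} := by
  rw [yOp_T]
  set c := (u : K) - ((u⁻¹ : Kˣ) : K) with hc
  have hmem (s : Finset ℕ) (g : ℕ → ℤ) (hg : ∀ i ∈ s, Succeeds (-(g i)) m) :
      piOp v (∑ i ∈ s, T (g i)) ∈ spanT {c | Succeeds c m} := by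
    rw [map_sum]
    refine Submodule.sum_mem _ fun i hi => ?_
    rw [piOp_T, ← smul_eq_C_mul]
    exact Submodule.smul_mem _ _ (T_mem_spanT (hg i hi))
  rcases lt_trichotomy m 0 with h | rfl | h
  · have e : divDiff (T m : LaurentPolynomial K) =
        ∑ i ∈ Finset.range (-m).toNat, T (2 * (i : ℤ) + m) := by
      rw [divDiff, onMonomials_T, if_neg (by omega)]
    rw [e, piOp_T, neg_neg, qWeight, if_neg (by omega), ← smul_eq_C_mul, smul_smul, Units.val_mul,
      mul_comm (u : K), add_sub_cancel_left]
    refine Submodule.smul_mem _ _ (hmem _ _ fun i hi => ?_)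
    rw [Finset.mem_range] at hi
    rw [succeeds_iff, position, position]
    split_ifs <;> omega
  · rw [divDiff_T_zero, map_zero, smul_zero, add_zero, piOp_T, qWeight, if_neg (by omega)]
    simp
  · obtain ⟨n, hn⟩ : ∃ n : ℕ, m = n + 1 := ⟨(m - 1).toNat, by omega⟩
    have e : divDiff (T m : LaurentPolynomial K) =
        -(T (-m) + ∑ i ∈ Finset.range n, T (2 * ((i + 1 : ℕ) : ℤ) - m)) := by
      rw [divDiff, onMonomials_T, if_pos h.le, show m.toNat = n + 1 by omega,
        Finset.sum_range_succ', add_comm]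
      simp
    rw [e, map_neg, map_add, piOp_T, neg_neg, qWeight, if_pos h, ← smul_eq_C_mul, Units.val_mul]
    have : (u : K) • ((v ^ (-m) : Kˣ) : K) • (T m : LaurentPolynomial K) +
        c • -(((v ^ (-m) : Kˣ) : K) • T m +
          piOp v (∑ i ∈ Finset.range n, T (2 * ((i + 1 : ℕ) : ℤ) - m))) -
        (((v ^ (-m) : Kˣ) : K) * ((u⁻¹ : Kˣ) : K)) • T m =
        -c • piOp v (∑ i ∈ Finset.range n, T (2 * ((i + 1 : ℕ) : ℤ) - m)) := by
      rw [hc]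
      module
    rw [this]
    refine Submodule.smul_mem _ _ (hmem _ _ fun i hi => ?_)
    rw [Finset.mem_range] at hi
    rw [succeeds_iff, position, position]
    split_ifs <;> push_cast at * <;> omega

theorem yOp_sub_mem (v u : Kˣ) {s : Set ℤ} (hs : ∀ d ∈ s, ∀ c, Succeeds c d → c ∈ s) (y : K)
    {f : LaurentPolynomial K} (hf : f ∈ spanT s) : yOp v u f - y • f ∈ spanT s := by
  suffices h : spanT s ≤ (spanT s).comap (yOp v u) from
    Submodule.sub_mem _ (h hf) (Submodule.smul_mem _ _ hf)
  rw [spanT, Submodule.span_le]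
  rintro _ ⟨d, hd, rfl⟩
  change yOp v u (T d) ∈ spanT s
  have h1 := spanT_mono (show {c | Succeeds c d} ⊆ s from fun c hc => hs d hd c hc)
    (yOp_T_sub_mem v u d)
  exact (Submodule.sub_mem_iff_left _ (Submodule.smul_mem _ _ (T_mem_spanT hd))).mp h1

/-- The coefficient of `Y f` at an exponent that comes last in `f`. -/
theorem coeff_yOp (v u : Kˣ) {f : LaurentPolynomial K} {c : ℤ}
    (hf : ∀ d, f.coeff d ≠ 0 → position d ≤ position c) :
    (yOp v u f).coeff c = qWeight v u c * f.coeff c := by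
  set B : Submodule K (LaurentPolynomial K) := spanT {d | position d < position c} with hB
  have h0 {g : LaurentPolynomial K} (hg : g ∈ B) : g.coeff c = 0 := by
    by_contra h
    exact lt_irrefl (position c) (mem_spanT.mp hg c h)
  have h1 : f - f.coeff c • T c ∈ B := by
    rw [hB, mem_spanT]
    intro d hd
    rw [coeff_sub, coeff_smul, coeff_T] at hd
    by_cases hdc : c = d
    · subst hdc
      simp at hd
    · rw [if_neg hdc, mul_zero, sub_zero] at hd
      exact lt_of_le_of_ne (hf d hd) fun h => hdc (position_injective h).symm
  have h2 := yOp_sub_mem v u (fun d hd e he => (Succeeds.position_lt he).trans hd) 0 h1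
  rw [zero_smul, sub_zero, map_sub, map_smul] at h2
  have h3 := spanT_mono (fun d hd => Succeeds.position_lt hd) (yOp_T_sub_mem v u c)
  have h4 := h0 (Submodule.add_mem _ h2 (Submodule.smul_mem _ (f.coeff c) h3))
  rw [smul_sub, sub_add_sub_cancel, coeff_sub, coeff_smul, coeff_smul, coeff_T, if_pos rfl,
    mul_one, sub_eq_zero] at h4
  rw [h4, mul_comm]

/-- By triangularity the last exponent c of a nonzero eigenvector forces its eigenvalue to be the
weight of c. -/
theorem eq_zero_of_yOp_eq (v u : Kˣ) {s : Set ℤ} {y : K} (hs : ∀ d ∈ s, (qWeight v u d : K) ≠ y)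
    {f : LaurentPolynomial K} (hf : f ∈ spanT s) (h : yOp v u f = y • f) : f = 0 := by
  by_contra h0
  have hne : f.coeff.support.Nonempty := by
    rw [Finset.nonempty_iff_ne_empty]
    intro h1
    exact h0 ((AddMonoidAlgebra.basis ℤ K).repr.map_eq_zero_iff.mp (Finsupp.support_eq_empty.mp h1))
  obtain ⟨c, hc, hmax⟩ := f.coeff.support.exists_max_image position hne
  rw [Finsupp.mem_support_iff] at hc
  have h1 := coeff_yOp v u fun d hd => hmax d (Finsupp.mem_support_iff.mpr hd)
  rw [h, coeff_smul] at h1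
  exact hs c (mem_spanT.mp hf c hc) (mul_right_cancel₀ hc h1).symm

theorem finite_succeeds (m : ℤ) : {c | Succeeds c m}.Finite := by
  refine (Set.finite_Icc (-|m|) |m|).subset fun c hc => ?_
  have hc : Succeeds c m := hc
  rw [Set.mem_Icc, ← abs_le]
  rcases hc with h | h
  · exact h.1.le
  · exact h.1.le

theorem isMacdonald_iff {v u : Kˣ} {m : ℤ} {E : PolyRep K v u} :
    IsMacdonald K v u m E ↔ yOp v u (toPoly K v u E) = (qWeight v u m : K) • toPoly K v u E ∧
      toPoly K v u E - T m ∈ spanT {c | Succeeds c m} := by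
  have : toPoly K v u (YOp K v u (PolyRep K v u) E) = yOp v u (toPoly K v u E) := by
    change toPoly K v u ((ofGen K v u .pi * ofGen K v u .T1) • E) = _
    rw [mul_smul, toPoly_pi, toPoly_T1]
    rfl
  rw [IsMacdonald, mem_spanT, ← this, ← map_smul, (toPoly K v u).injective.eq_iff]
  rfl

/-- The polynomial `E_m` exists and is unique if its weight differs from those below. -/
theorem existsUnique_isMacdonald {v u : Kˣ} {m : ℤ}
    (hm : ∀ c, Succeeds c m → (qWeight v u c : K) ≠ qWeight v u m) :
    ∃! E, IsMacdonald K v u m E := by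
  set y : K := (qWeight v u m : K) with hy
  set W : Submodule K (LaurentPolynomial K) := spanT {c | Succeeds c m} with hW
  have hs : ∀ d ∈ {c | Succeeds c m}, ∀ c, Succeeds c d → c ∈ {c | Succeeds c m} :=
    fun d hd c hc => Succeeds.trans hc hd
  have hfin : FiniteDimensional K W :=
    FiniteDimensional.span_of_finite K ((finite_succeeds m).image _)
  let B : W →ₗ[K] W := (yOp v u - y • 1).restrict fun f hf => yOp_sub_mem v u hs y hf
  have hinj : Function.Injective B := by
    rw [← LinearMap.ker_eq_bot, LinearMap.ker_eq_bot']
    intro f hf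
    have h1 := congrArg Subtype.val hf
    apply Subtype.ext
    exact eq_zero_of_yOp_eq v u hm f.2 (sub_eq_zero.mp h1)
  -- Injectivity on the finite-dimensional span of lower monomials gives surjectivity, so some lower
  -- w has the same image under Y - y as X^m; then E_m = X^m - w.
  obtain ⟨w, hw⟩ := (LinearMap.injective_iff_surjective.mp hinj)
    ⟨_, yOp_T_sub_mem v u m⟩
  have hw' : yOp v u w.1 - y • w.1 = yOp v u (T m) - y • T m := congrArg Subtype.val hw
  refine ⟨ofPoly K v u (T m - w.1), ?_, ?_⟩
  · refine isMacdonald_iff.mpr ?_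
    rw [LinearEquiv.apply_symm_apply]
    refine ⟨?_, ?_⟩
    · rw [map_sub, smul_sub]
      linear_combination (exp := 1) -hw'
    · rw [sub_sub_cancel_left]
      exact W.neg_mem w.2
  · intro E hE
    rw [isMacdonald_iff] at hE
    apply (toPoly K v u).injective
    rw [LinearEquiv.apply_symm_apply, ← sub_eq_zero]
    refine eq_zero_of_yOp_eq v u hm (f := toPoly K v u E - (T m - w.1)) ?_ ?_
    · rw [← sub_add]
      exact W.add_mem hE.2 w.2
    · rw [map_sub, map_sub, hE.1, smul_sub, smul_sub]
      linear_combination (exp := 1) hw'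

end Triangular

/-! ### The quotient by the ideal -/

section Quotient

variable {K : Type*} [Field K] {v : Kˣ} {N : ℕ} {a : ℤ}

theorem genPoly_monic : (genPoly v N a).Monic :=
  Polynomial.monic_prod_of_monic _ _ fun _ _ => (Polynomial.monic_X_sub_C _).pow _

theorem card_doubleRoots (ha : 0 < a) (haN : 2 * a ≤ N) :
    ((doubleRoots N a).card : ℤ) = 4 * a := by
  rw [doubleRoots, Finset.card_union_of_disjoint, Finset.card_union_of_disjoint]
  · simp only [Int.card_Icc]
    omega
  · rw [Finset.disjoint_left]
    intro i
    simp only [Finset.mem_Icc]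
    omega
  · rw [Finset.disjoint_left]
    intro i
    simp only [Finset.mem_union, Finset.mem_Icc]
    omega

theorem natDegree_genPoly (ha : 0 < a) (haN : 2 * a ≤ N) {M : ℕ} (hM : (M : ℤ) = N + 2 * a) :
    (genPoly v N a).natDegree = 2 * M := by
  rw [genPoly, Polynomial.natDegree_prod_of_monic _ _
    fun _ _ => (Polynomial.monic_X_sub_C _).pow _]
  simp only [Polynomial.natDegree_pow, Polynomial.natDegree_X_sub_C, mul_one]
  have h : ∀ j, rootMult N a j = 1 + if j ∈ doubleRoots N a then 1 else 0 := fun j => by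
    rw [rootMult]; split_ifs <;> rfl
  simp only [h, Finset.sum_add_distrib, Finset.sum_const, Finset.sum_ite_mem, smul_eq_mul, mul_one]
  have h2 : Finset.Icc (1 - (N : ℤ)) N ∩ doubleRoots N a = doubleRoots N a := by
    rw [Finset.inter_eq_right]
    intro j
    simp only [mem_doubleRoots, Finset.mem_Icc]
    omega
  have h3 := card_doubleRoots ha haN
  rw [h2, Int.card_Icc]
  omega

theorem isCoprime_genPoly_X : IsCoprime (genPoly v N a) Polynomial.X := by
  refine IsCoprime.prod_left fun j _ => IsCoprime.pow_left ?_
  have := Polynomial.isCoprime_X_sub_C_of_isUnit_sub (R := K) (a := ((v ^ j : Kˣ) : K)) (b := 0)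
    (by rw [sub_zero]; exact (v ^ j).isUnit)
  simpa using this

/-- Clearing denominators introduces only a power of X, and this is coprime to g. -/
theorem dvd_of_toLaurent_dvd {g p : Polynomial K} (hg : IsCoprime g Polynomial.X)
    (h : Polynomial.toLaurent g ∣ Polynomial.toLaurent p) : g ∣ p := by
  obtain ⟨h, hh⟩ := h
  obtain ⟨n, h', hn⟩ := exists_T_pow h
  have : p * Polynomial.X ^ n = g * h' := by
    apply Polynomial.toLaurent_injective
    rw [map_mul, map_mul, Polynomial.toLaurent_X_pow, hh, hn, mul_assoc]
  exact (hg.pow_right (n := n)).dvd_of_dvd_mul_right (Dvd.intro _ this.symm)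

theorem toLaurent_mem_spanT {n : ℕ} {p : Polynomial K} (hp : p ∈ Polynomial.degreeLT K n) (b : ℤ) :
    T b * Polynomial.toLaurent p ∈ spanT (Set.Ico b (b + n)) := by
  classical
  suffices h : Polynomial.degreeLT K n ≤ (spanT (K := K) (Set.Ico b (b + n))).comap
      (LinearMap.mulLeft K (T b) ∘ₗ (Polynomial.toLaurentAlg (R := K)).toLinearMap) from h hp
  rw [Polynomial.degreeLT_eq_span_X_pow, Submodule.span_le]
  intro x hx
  obtain ⟨i, hi, rfl⟩ := Finset.mem_image.mp (Finset.mem_coe.mp hx)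
  rw [Finset.mem_range] at hi
  change (T b * Polynomial.toLaurent (Polynomial.X ^ i) : LaurentPolynomial K) ∈
    spanT (Set.Ico b (b + n))
  rw [Polynomial.toLaurent_X_pow, ← T_add]
  exact T_mem_spanT (by rw [Set.mem_Ico]; omega)

theorem exists_toLaurent_of_mem_spanT {n : ℕ} {b : ℤ} {f : LaurentPolynomial K}
    (hf : f ∈ spanT (Set.Ico b (b + n))) :
    ∃ p ∈ Polynomial.degreeLT K n, T (-b) * f = Polynomial.toLaurent p := by
  suffices h : spanT (K := K) (Set.Ico b (b + n)) ≤ ((Polynomial.degreeLT K n).map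
      (Polynomial.toLaurentAlg (R := K)).toLinearMap).comap (LinearMap.mulLeft K (T (-b))) by
    obtain ⟨p, hp, h⟩ := h hf
    exact ⟨p, hp, h.symm⟩
  rw [spanT, Submodule.span_le]
  rintro _ ⟨c, hc, rfl⟩
  rw [Set.mem_Ico] at hc
  refine ⟨Polynomial.X ^ (c - b).toNat, ?_, ?_⟩
  · rw [SetLike.mem_coe, Polynomial.mem_degreeLT, Polynomial.degree_X_pow]
    exact_mod_cast (by omega : (c - b).toNat < n)
  · change Polynomial.toLaurent _ = T (-b) * T c
    rw [Polynomial.toLaurent_X_pow, ← T_add]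
    congr 1
    omega

/-- After a shift f is a polynomial of degree below deg g, so it cannot be a nonzero multiple of g.
This is used for the independence of monomials in V and to lift equalities from V to 𝒱. -/
theorem eq_zero_of_dvd_of_mem_spanT {g : Polynomial K} (hg : IsCoprime g Polynomial.X)
    {n : ℕ} (hn : g.natDegree = n) (hm : g.Monic) {b : ℤ} {f : LaurentPolynomial K}
    (hf : f ∈ spanT (Set.Ico b (b + n))) (h : g.toLaurent ∣ f) : f = 0 := by
  obtain ⟨p, hp, h1⟩ := exists_toLaurent_of_mem_spanT hf
  have h2 : g ∣ p := dvd_of_toLaurent_dvd hg (h1 ▸ h.mul_left _)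
  have h3 : p = 0 := by
    apply Polynomial.eq_zero_of_dvd_of_degree_lt h2
    rw [Polynomial.degree_eq_natDegree hm.ne_zero, hn]
    exact Polynomial.mem_degreeLT.mp hp
  rw [h3, map_zero] at h1
  have e := TT (K := K) b
  linear_combination T b * h1 - f * e

theorem exists_mem_spanT_dvd_sub {g : Polynomial K} (hg : IsCoprime g Polynomial.X)
    {n : ℕ} (hn : g.natDegree = n) (hm : g.Monic) (k : ℕ) (f : LaurentPolynomial K) :
    ∃ w ∈ spanT (Set.Ico (-(k : ℤ)) (-k + n)), g.toLaurent ∣ f - w := by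
  obtain ⟨m, p, hp⟩ := exists_T_pow f
  obtain ⟨x, y, hxy⟩ := hg
  -- Since x g + y X = 1, y inverts X modulo g. Hence q represents X^k f, and its remainder divided
  -- by X^k lies in the required window.
  set q := p * Polynomial.X ^ k * y ^ m with hq
  set r := q %ₘ g with hr
  refine ⟨T (-k) * Polynomial.toLaurent r, toLaurent_mem_spanT ?_ _, ?_⟩
  · rw [Polynomial.mem_degreeLT, hr, ← hn, ← Polynomial.degree_eq_natDegree hm.ne_zero]
    exact Polynomial.degree_modByMonic_lt _ hm
  · have h1 : g.toLaurent ∣ q.toLaurent - r.toLaurent := by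
      rw [← map_sub]
      refine map_dvd _ ⟨q /ₘ g, ?_⟩
      have := Polynomial.modByMonic_add_div q g
      linear_combination -this
    have h2 : g.toLaurent ∣ 1 - (y.toLaurent * T 1) ^ m := by
      have h3 : g.toLaurent ∣ 1 - y.toLaurent * T 1 := by
        refine ⟨x.toLaurent, ?_⟩
        have := congrArg Polynomial.toLaurent hxy
        rw [map_add, map_mul, map_mul, map_one, Polynomial.toLaurent_X] at this
        linear_combination -this
      refine h3.trans ?_
      have := sub_dvd_pow_sub_pow (1 : LaurentPolynomial K) (y.toLaurent * T 1) m
      rwa [one_pow] at this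
    have h4 : q.toLaurent = f * T k * (y.toLaurent * T 1) ^ m := by
      rw [hq, map_mul, map_mul, Polynomial.toLaurent_X_pow, map_pow, hp, mul_pow, ← T_natCast]
      ring
    have h5 : f - T (-k) * r.toLaurent = f * (1 - (y.toLaurent * T 1) ^ m) +
        T (-k) * (q.toLaurent - r.toLaurent) := by
      rw [h4]
      linear_combination (-f * (y.toLaurent * T 1) ^ m) * TT (K := K) k
    rw [h5]
    exact dvd_add (h2.mul_left _) (h1.mul_left _)

/-- The sequence `0, 1, -1, 2, -2, …`. -/
def seqIndex (i : ℕ) : ℤ := if i % 2 = 0 then -(i / 2 : ℕ) else ((i + 1) / 2 : ℕ)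

theorem position_seqIndex (i : ℕ) : position (seqIndex i) = i := by
  unfold position seqIndex
  split_ifs <;> omega

theorem seqIndex_mem {M i : ℕ} : seqIndex i ∈ Set.Ico (-((M : ℤ) - 1)) (M + 1) ↔ i < 2 * M := by
  unfold seqIndex
  rw [Set.mem_Ico]
  split_ifs <;> omega

theorem seqIndex_injective : Function.Injective seqIndex := fun i j h => by
  have := congrArg position h
  rw [position_seqIndex, position_seqIndex] at this
  exact_mod_cast this

theorem seqIndex_position (m : ℤ) : seqIndex (position m).toNat = m := by
  apply position_injective
  rw [position_seqIndex]
  unfold position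
  split_ifs <;> omega

variable {Q : Type*} [AddCommGroup Q] [Module K Q]

/-- Monomials give a basis of the quotient. -/
theorem exists_basis {g : Polynomial K} (hg : IsCoprime g Polynomial.X) (hm : g.Monic)
    {M : ℕ} (hM : 0 < M) (hn : g.natDegree = 2 * M) {q : LaurentPolynomial K →ₗ[K] Q}
    (hq : Function.Surjective q) (hker : ∀ f, q f = 0 ↔ g.toLaurent ∣ f) :
    ∃ b : Module.Basis (Fin (2 * M)) K Q, ∀ i, b i = q (T (seqIndex i)) := by
  have hset : Set.range (fun i : Fin (2 * M) => (T (seqIndex i) : LaurentPolynomial K)) =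
      T '' Set.Ico (-((M - 1 : ℕ) : ℤ)) (-((M - 1 : ℕ) : ℤ) + (2 * M : ℕ)) := by
    have e : Set.Ico (-((M - 1 : ℕ) : ℤ)) (-((M - 1 : ℕ) : ℤ) + (2 * M : ℕ)) =
        Set.Ico (-((M : ℤ) - 1)) (M + 1) := by
      congr 1 <;> omega
    rw [e]
    ext f
    constructor
    · rintro ⟨i, rfl⟩
      exact ⟨_, seqIndex_mem.mpr i.2, rfl⟩
    · rintro ⟨c, hc, rfl⟩
      rw [← seqIndex_position c, seqIndex_mem] at hc
      exact ⟨⟨_, hc⟩, by simp [seqIndex_position]⟩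
  have hspan : Submodule.span K (Set.range
      (fun i : Fin (2 * M) => (T (seqIndex i) : LaurentPolynomial K))) =
      spanT (Set.Ico (-((M - 1 : ℕ) : ℤ)) (-((M - 1 : ℕ) : ℤ) + (2 * M : ℕ))) := by
    rw [hset, spanT]
  have hli : LinearIndependent K (fun i : Fin (2 * M) => q (T (seqIndex i))) := by
    refine LinearIndependent.map (f := q)
      (((AddMonoidAlgebra.basis ℤ K).linearIndependent).comp (fun i : Fin (2 * M) => seqIndex i)
        (seqIndex_injective.comp Fin.val_injective)) ?_
    rw [Submodule.disjoint_def]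
    intro f hf h0
    exact eq_zero_of_dvd_of_mem_spanT hg hn hm (hspan ▸ hf) ((hker f).mp h0)
  refine ⟨Module.Basis.mk hli ?_, fun i => Module.Basis.mk_apply _ _ i⟩
  intro x _
  obtain ⟨f, rfl⟩ := hq x
  obtain ⟨w, hw, hd⟩ := exists_mem_spanT_dvd_sub hg hn hm (M - 1) f
  have h1 : q f = q w := by rw [← sub_eq_zero, ← map_sub, hker]; exact hd
  rw [← hspan] at hw
  rw [h1, show (fun i : Fin (2 * M) => q (T (seqIndex i))) =
    q ∘ fun i : Fin (2 * M) => T (seqIndex i) from rfl,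
    Set.range_comp, Submodule.span_image]
  exact Submodule.mem_map_of_mem hw

variable [FiniteDimensional K Q]

/-- In the basis of monomials ordered by position the matrix is upper triangular, with the weights
on the diagonal. -/
theorem charpoly_eq {u : Kˣ} {n : ℕ} (b : Module.Basis (Fin n) K Q)
    {q : LaurentPolynomial K →ₗ[K] Q}
    (hb : ∀ i, b i = q (T (seqIndex i))) {A : Module.End K Q}
    (hA : ∀ f, A (q f) = q (yOp v u f)) :
    A.charpoly = ∏ i : Fin n,
      (Polynomial.X - Polynomial.C ((qWeight v u (seqIndex i) : Kˣ) : K)) := by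
  have key (j : Fin n) : A (b j) - (qWeight v u (seqIndex j) : K) • b j ∈
      Submodule.span K (b '' {i | i < j}) := by
    rw [hb, hA, ← map_smul, ← map_sub]
    have h1 := Submodule.mem_map_of_mem (f := q) (yOp_T_sub_mem v u (seqIndex j))
    rw [spanT, Submodule.map_span] at h1
    refine Submodule.span_mono ?_ h1
    rintro _ ⟨_, ⟨c, hc, rfl⟩, rfl⟩
    have hc : position c < position (seqIndex j) := Succeeds.position_lt hc
    rw [position_seqIndex, ← seqIndex_position c, position_seqIndex] at hc
    have hlt : (position c).toNat < j := by exact_mod_cast hc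
    refine ⟨⟨(position c).toNat, hlt.trans j.2⟩, hlt, ?_⟩
    rw [hb, seqIndex_position]
  have hz (i j : Fin n) (h : j ≤ i) :
      b.repr (A (b j)) i = (qWeight v u (seqIndex j) : K) * b.repr (b j) i := by
    have h1 := (b.mem_span_image).mp (key j)
    have h2 : b.repr (A (b j) - (qWeight v u (seqIndex j) : K) • b j) i = 0 := by
      by_contra h0
      exact absurd (h1 (Finsupp.mem_support_iff.mpr h0)) (not_lt.mpr h)
    rwa [map_sub, map_smul, Finsupp.sub_apply, Finsupp.smul_apply, smul_eq_mul, sub_eq_zero] at h2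
  rw [← LinearMap.charpoly_toMatrix A b, Matrix.charpoly_of_isUpperTriangular]
  · refine Finset.prod_congr rfl fun i _ => ?_
    rw [LinearMap.toMatrix_apply, hz i i le_rfl, b.repr_self, Finsupp.single_eq_same, mul_one]
  · intro i j hij
    rw [LinearMap.toMatrix_apply, hz i j (le_of_lt hij), b.repr_self,
      Finsupp.single_eq_of_ne (show i ≠ j from ne_of_gt hij), mul_zero]

/-- The dimension is the multiplicity of y as a root of the characteristic polynomial, so it becomes
a count of indices. -/
theorem finrank_maxGenEigenspace {u : Kˣ} {M : ℕ} (b : Module.Basis (Fin (2 * M)) K Q)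
    {q : LaurentPolynomial K →ₗ[K] Q} (hb : ∀ i, b i = q (T (seqIndex i))) {A : Module.End K Q}
    (hA : ∀ f, A (q f) = q (yOp v u f)) (y : Kˣ) [DecidableEq Kˣ] :
    Module.finrank K (A.maxGenEigenspace (y : K)) =
      ((Finset.Icc (1 - (M : ℤ)) M).filter fun m => qWeight v u m = y).card := by
  classical
  rw [LinearMap.finrank_maxGenEigenspace_eq, charpoly_eq b hb hA, ← Polynomial.count_roots]
  have h1 : (∏ i : Fin (2 * M),
      (Polynomial.X - Polynomial.C ((qWeight v u (seqIndex i) : Kˣ) : K))).roots =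
      Finset.univ.val.map fun i : Fin (2 * M) => ((qWeight v u (seqIndex i) : Kˣ) : K) := by
    rw [Finset.prod_eq_multiset_prod, ← Polynomial.roots_multiset_prod_X_sub_C
      (Finset.univ.val.map fun i : Fin (2 * M) => ((qWeight v u (seqIndex i) : Kˣ) : K)),
      Multiset.map_map]
    rfl
  rw [h1, Multiset.count_map]
  change (Finset.univ.filter fun i : Fin (2 * M) =>
    (y : K) = ((qWeight v u (seqIndex i) : Kˣ) : K)).card = _
  refine Finset.card_bij (fun i _ => seqIndex i) ?_ ?_ ?_
  · intro i hi
    rw [Finset.mem_filter] at hi ⊢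
    have := seqIndex_mem.mpr i.2
    rw [Set.mem_Ico] at this
    exact ⟨by rw [Finset.mem_Icc]; omega, (Units.ext hi.2).symm⟩
  · intro i _ j _ h
    exact Fin.ext (seqIndex_injective h)
  · intro m hm
    rw [Finset.mem_filter, Finset.mem_Icc] at hm
    have h2 : (position m).toNat < 2 * M := by
      rw [← seqIndex_mem, seqIndex_position, Set.mem_Ico]
      omega
    refine ⟨⟨_, h2⟩, ?_, seqIndex_position m⟩
    rw [Finset.mem_filter]
    simp [seqIndex_position, hm.2]

end Quotient

/-! ### Generalized eigenspaces -/

section LinearAlgebra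

variable {K Q : Type*} [Field K] [AddCommGroup Q] [Module K Q] {A : Module.End K Q}

theorem exists_pow_apply_ne_zero {B : Module.End K Q} {x : Q} (hx : x ≠ 0)
    (h : ∃ k : ℕ, (B ^ k) x = 0) :
    ∃ k : ℕ, (B ^ k) x ≠ 0 ∧ B ((B ^ k) x) = 0 := by
  classical
  have h1 : Nat.find h ≠ 0 := fun h0 => hx (by simpa [h0] using Nat.find_spec h)
  refine ⟨Nat.find h - 1, Nat.find_min h (by omega), ?_⟩
  have h2 := Nat.find_spec h
  rw [← Module.End.mul_apply, ← pow_succ', Nat.sub_add_cancel (by omega)]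
  exact h2

theorem sub_smul_apply (μ : K) (x : Q) : (A - μ • (1 : Module.End K Q)) x = A x - μ • x := rfl

theorem pow_sub_smul_mem {μ : K} {x : Q} (hx : x ∈ A.maxGenEigenspace μ) (k : ℕ) :
    ((A - μ • (1 : Module.End K Q)) ^ k) x ∈ A.maxGenEigenspace μ := by
  rw [Module.End.mem_maxGenEigenspace] at hx ⊢
  obtain ⟨n, hn⟩ := hx
  refine ⟨n, ?_⟩
  rw [← Module.End.mul_apply, ← pow_add, add_comm, pow_add, Module.End.mul_apply, hn, map_zero]

theorem eigenspace_le (μ : K) : A.eigenspace μ ≤ A.maxGenEigenspace μ := by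
  intro x hx
  rw [Module.End.mem_eigenspace_iff] at hx
  rw [Module.End.mem_maxGenEigenspace]
  exact ⟨1, by rw [pow_one, sub_smul_apply, hx, sub_self]⟩

variable [FiniteDimensional K Q]

theorem maxGenEigenspace_eq_of_finrank_eq_one {μ : K}
    (h : Module.finrank K (A.maxGenEigenspace μ) = 1) : A.maxGenEigenspace μ = A.eigenspace μ := by
  symm
  apply Submodule.eq_of_le_of_finrank_le (eigenspace_le μ)
  rw [h, Nat.one_le_iff_ne_zero, ← pos_iff_ne_zero, Module.finrank_pos_iff]
  obtain ⟨x, hx, hx0⟩ := Submodule.exists_mem_ne_zero_of_ne_bot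
    (fun h0 : A.maxGenEigenspace μ = ⊥ => by rw [h0, finrank_bot] at h; exact zero_ne_one h)
  obtain ⟨k, hk, hk0⟩ := exists_pow_apply_ne_zero hx0 (Module.End.mem_maxGenEigenspace .. |>.mp hx)
  rw [sub_smul_apply, sub_eq_zero] at hk0
  exact ⟨⟨⟨_, Module.End.mem_eigenspace_iff.mpr hk0⟩, 0, fun h => hk (congrArg Subtype.val h)⟩⟩

theorem isJordanTwoBlock_of_finrank {μ : K} (h2 : Module.finrank K (A.maxGenEigenspace μ) = 2)
    (h1 : Module.finrank K (A.eigenspace μ) ≤ 1) :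
    IsJordanTwoBlock A μ (A.maxGenEigenspace μ) := by
  obtain ⟨x, hx, hxe⟩ : ∃ x ∈ A.maxGenEigenspace μ, x ∉ A.eigenspace μ := by
    by_contra! h
    have := Submodule.finrank_mono (show A.maxGenEigenspace μ ≤ A.eigenspace μ from h)
    omega
  rw [Module.End.mem_eigenspace_iff, ← sub_eq_zero, ← sub_smul_apply] at hxe
  obtain ⟨n, hn⟩ := Module.End.mem_maxGenEigenspace .. |>.mp hx
  -- Let k be the last power of A - μ not killing (A - μ) x. Then f = (A - μ)^k x and e = (A - μ) f
  -- form a Jordan chain of length two.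
  obtain ⟨k, hk, hk0⟩ := exists_pow_apply_ne_zero hxe ⟨n, by
    rw [← Module.End.mul_apply, ← pow_succ, pow_succ', Module.End.mul_apply, hn, map_zero]⟩
  have hf : ((A - μ • (1 : Module.End K Q)) ^ k) x ∈ A.maxGenEigenspace μ := pow_sub_smul_mem hx k
  have he := pow_sub_smul_mem hx (k + 1)
  have hcomm : ((A - μ • (1 : Module.End K Q)) ^ k) ((A - μ • (1 : Module.End K Q)) x) =
      (A - μ • (1 : Module.End K Q)) (((A - μ • (1 : Module.End K Q)) ^ k) x) := by
    rw [← Module.End.mul_apply, ← pow_succ, pow_succ', Module.End.mul_apply]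
  rw [hcomm] at hk hk0
  rw [pow_succ', Module.End.mul_apply] at he
  set f := ((A - μ • (1 : Module.End K Q)) ^ k) x
  set e := (A - μ • (1 : Module.End K Q)) f with he'
  rw [sub_smul_apply] at he'
  rw [sub_smul_apply, sub_eq_zero] at hk0
  have hli : LinearIndependent K ![e, f] := by
    rw [LinearIndependent.pair_iff]
    intro s t hst
    have h3 := congrArg (A - μ • (1 : Module.End K Q)) hst
    rw [map_add, map_smul, map_smul, map_zero, sub_smul_apply, hk0, sub_self, smul_zero,
      zero_add] at h3
    have ht : t = 0 := (smul_eq_zero.mp h3).resolve_right hk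
    rw [ht, zero_smul, add_zero] at hst
    exact ⟨(smul_eq_zero.mp hst).resolve_right hk, ht⟩
  refine ⟨e, f, hli, ?_, hk0, by rw [he']; abel⟩
  symm
  have hle : Submodule.span K {e, f} ≤ A.maxGenEigenspace μ := by
    rw [Submodule.span_le]
    rintro _ (rfl | rfl)
    · exact he
    · exact hf
  apply Submodule.eq_of_le_of_finrank_le hle
  rw [h2]
  have := finrank_span_eq_card hli
  rw [Matrix.range_cons, Matrix.range_cons, Matrix.range_empty, Set.union_empty,
    Set.singleton_union] at this
  rw [this, Fintype.card_fin]

theorem finrank_biSup_eq_sum {ι : Type*} {V : ι → Submodule K Q} (hV : iSupIndep V) (s : Finset ι) :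
    Module.finrank K (⨆ i ∈ s, V i : Submodule K Q) = ∑ i ∈ s, Module.finrank K (V i) := by
  classical
  induction s using Finset.induction_on with
  | empty => simp
  | insert i s hi ih =>
    have hd : Disjoint (V i) (⨆ j ∈ s, V j) :=
      hV.disjoint_biSup (y := (s : Set ι)) (x := i) (by simpa using hi)
    rw [Finset.iSup_insert, Finset.sum_insert hi, ← ih, ← Submodule.finrank_sup_add_finrank_inf_eq,
      hd.eq_bot, finrank_bot, add_zero]

/-- If the generalized eigenspaces for the eigenvalues `w j`, `j ∈ s`, fill the space, then the
semisimple and nonsemisimple parts are obtained from a partition of `s`. -/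
theorem semisimplePart_structure {s t : Finset ℤ} {w : ℤ → K}
    (hw : Set.InjOn w ((s ∪ t : Finset ℤ) : Set ℤ)) (hst : Disjoint s t)
    (hs : ∀ j ∈ s, A.maxGenEigenspace (w j) = A.eigenspace (w j))
    (ht : ∀ j ∈ t, A.maxGenEigenspace (w j) ≠ A.eigenspace (w j))
    (hsum : ∑ j ∈ s ∪ t, Module.finrank K (A.maxGenEigenspace (w j)) = Module.finrank K Q) :
    semisimplePart A = ⨆ j ∈ s, A.eigenspace (w j) ∧
    nonsemisimplePart A = ⨆ j ∈ t, A.maxGenEigenspace (w j) ∧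
    Module.finrank K (semisimplePart A) =
      ∑ j ∈ s, Module.finrank K (A.maxGenEigenspace (w j)) ∧
    Module.finrank K (nonsemisimplePart A) =
      ∑ j ∈ t, Module.finrank K (A.maxGenEigenspace (w j)) ∧
    IsCompl (semisimplePart A) (nonsemisimplePart A) := by
  classical
  have hind := A.independent_maxGenEigenspace
  have hfin (r : Finset ℤ) (hr : r ⊆ s ∪ t) :
      Module.finrank K (⨆ j ∈ r, A.maxGenEigenspace (w j) : Submodule K Q) =
        ∑ j ∈ r, Module.finrank K (A.maxGenEigenspace (w j)) := by
    rw [← Finset.sum_image (f := fun μ => Module.finrank K (A.maxGenEigenspace μ))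
      (hw.mono (Finset.coe_subset.mpr hr)), ← finrank_biSup_eq_sum hind, Finset.iSup_finset_image]
  have htop : (⨆ j ∈ s ∪ t, A.maxGenEigenspace (w j) : Submodule K Q) = ⊤ := by
    apply Submodule.eq_top_of_finrank_eq
    rw [hfin _ subset_rfl, hsum]
  -- Generalized eigenspaces are independent and the listed ones already fill the space, so no other
  -- eigenvalue occurs.
  have hout (μ : K) (hμ : ∀ j ∈ s ∪ t, w j ≠ μ) : A.maxGenEigenspace μ = ⊥ := by
    have h1 := hind.disjoint_biSup (y := ((s ∪ t).image w : Set K)) (x := μ) (by simpa using hμ)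
    have h2 : (⨆ i ∈ ((s ∪ t).image w : Set K), A.maxGenEigenspace i) = ⊤ := by
      rw [← htop, ← Finset.iSup_finset_image]
      rfl
    rwa [h2, disjoint_top] at h1
  have e1 : semisimplePart A = ⨆ j ∈ s, A.maxGenEigenspace (w j) := by
    apply le_antisymm
    · refine iSup₂_le fun μ hμ => ?_
      by_cases h : ∃ j ∈ s ∪ t, w j = μ
      · obtain ⟨j, hj, rfl⟩ := h
        rcases Finset.mem_union.mp hj with hj | hj
        · exact le_iSup₂_of_le j hj le_rfl
        · exact absurd hμ (ht j hj)
      · push Not at h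
        rw [hout μ h]
        exact bot_le
    · exact iSup₂_le fun j hj => le_iSup₂_of_le (w j) (hs j hj) le_rfl
  have e2 : nonsemisimplePart A = ⨆ j ∈ t, A.maxGenEigenspace (w j) := by
    apply le_antisymm
    · refine iSup₂_le fun μ hμ => ?_
      by_cases h : ∃ j ∈ s ∪ t, w j = μ
      · obtain ⟨j, hj, rfl⟩ := h
        rcases Finset.mem_union.mp hj with hj | hj
        · exact absurd (hs j hj) hμ
        · exact le_iSup₂_of_le j hj le_rfl
      · push Not at h
        rw [hout μ h]
        exact bot_le
    · exact iSup₂_le fun j hj => le_iSup₂_of_le (w j) (ht j hj) le_rfl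
  have f1 := hfin s Finset.subset_union_left
  have f2 := hfin t Finset.subset_union_right
  have hsup : semisimplePart A ⊔ nonsemisimplePart A = ⊤ := by
    rw [← htop, e1, e2, Finset.iSup_union]
  rw [← e1] at f1
  rw [← e2] at f2
  refine ⟨?_, e2, f1, f2, ?_⟩
  · rw [e1]
    exact iSup_congr fun j => iSup_congr fun hj => hs j hj
  · refine ⟨?_, codisjoint_iff.mpr hsup⟩
    have h := Submodule.finrank_sup_add_finrank_inf_eq (semisimplePart A) (nonsemisimplePart A)
    rw [hsup, finrank_top, f1, f2, ← Finset.sum_union hst, hsum] at h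
    rw [disjoint_iff, ← Submodule.finrank_eq_zero (R := K)]
    omega

end LinearAlgebra

/-! ### Combinatorics of the weights -/

section Weights

variable {K : Type*} [Field K] {v : Kˣ} {N : ℕ} {a : ℤ}

/-- The exponent of the weight of `E_m`. -/
def weightExp (a m : ℤ) : ℤ := if 0 < m then a - m else -m - a

theorem qWeight_eq (v : Kˣ) (a m : ℤ) : qWeight v (v ^ (-a)) m = v ^ weightExp a m := by
  rw [qWeight, weightExp]
  split_ifs
  · rw [← zpow_neg, ← zpow_add]
    congr 1
    ring
  · rw [← zpow_add]
    congr 1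

/-- The exponents compared later differ by less than 4N, so congruence modulo 2N reduces to three
linear cases. -/
theorem zpow_eq_iff_of_abs_lt (hv : IsPrimitiveRoot v (2 * N)) {i j : ℤ}
    (h1 : -(4 * N : ℤ) < i - j) (h2 : i - j < 4 * N) :
    v ^ i = v ^ j ↔ i - j = 0 ∨ i - j = 2 * N ∨ i - j = -(2 * N) := by
  rw [zpow_eq_iff hv]
  constructor
  · intro h
    exact cases_of_dvd h (by omega) (by omega)
  · rintro (h | h | h) <;> rw [h]
    · exact dvd_zero _
    · exact dvd_neg.mpr dvd_rfl

theorem mem_simpleWeights {j : ℤ} : j ∈ simpleWeights N a ↔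
    (a ≤ j ∧ j ≤ N - 1 - a) ∨ (a - N ≤ j ∧ j ≤ -a - 1) := by
  simp [simpleWeights]

theorem mem_doubleWeights {j : ℤ} : j ∈ doubleWeightsFirst a ∪ doubleWeightsSecond N a ↔
    (-a ≤ j ∧ j ≤ a - 1) ∨ (N - a ≤ j ∧ j ≤ N - 1) ∨ (-N ≤ j ∧ j ≤ a - N - 1) := by
  simp [doubleWeightsFirst, doubleWeightsSecond]

theorem card_simpleWeights (ha : 0 < a) (haN : 2 * a ≤ N) :
    ((simpleWeights N a).card : ℤ) = 2 * N - 4 * a := by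
  rw [simpleWeights, Finset.card_union_of_disjoint]
  · simp only [Int.card_Icc]
    omega
  · rw [Finset.disjoint_left]
    intro i
    simp only [Finset.mem_Icc]
    omega

theorem card_doubleWeights (ha : 0 < a) (haN : 2 * a ≤ N) :
    ((doubleWeightsFirst a ∪ doubleWeightsSecond N a).card : ℤ) = 4 * a := by
  rw [doubleWeightsFirst, doubleWeightsSecond, Finset.card_union_of_disjoint,
    Finset.card_union_of_disjoint]
  · simp only [Int.card_Icc]
    omega
  · rw [Finset.disjoint_left]
    intro i
    simp only [Finset.mem_Icc]
    omega
  · rw [Finset.disjoint_left]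
    intro i
    simp only [Finset.mem_union, Finset.mem_Icc]
    omega

theorem disjoint_weights :
    Disjoint (simpleWeights N a) (doubleWeightsFirst a ∪ doubleWeightsSecond N a) := by
  rw [Finset.disjoint_left]
  intro i
  rw [mem_simpleWeights, mem_doubleWeights]
  omega

theorem injOn_weights (hv : IsPrimitiveRoot v (2 * N)) (ha : 0 < a) (haN : 2 * a ≤ N) :
    Set.InjOn (fun j : ℤ => v ^ j) ((simpleWeights N a ∪
      (doubleWeightsFirst a ∪ doubleWeightsSecond N a) : Finset ℤ) : Set ℤ) := by
  intro i hi j hj h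
  rw [Finset.mem_coe, Finset.mem_union, mem_simpleWeights, mem_doubleWeights] at hi hj
  have h : v ^ i = v ^ j := h
  rw [zpow_eq_iff_of_abs_lt hv (by omega) (by omega)] at h
  omega

theorem card_filter_simple (hv : IsPrimitiveRoot v (2 * N)) (ha : 0 < a) (haN : 2 * a ≤ N) {M : ℕ}
    (hM : (M : ℤ) = N + 2 * a) [DecidableEq Kˣ] {j : ℤ} (hj : j ∈ simpleWeights N a) :
    ((Finset.Icc (1 - (M : ℤ)) M).filter fun m => qWeight v (v ^ (-a)) m = v ^ j).card = 1 := by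
  rw [mem_simpleWeights] at hj
  rw [Finset.card_eq_one]
  have hm (m : ℤ) (hm : 1 - (M : ℤ) ≤ m ∧ m ≤ M) := zpow_eq_iff_of_abs_lt hv (i := weightExp a m)
    (j := j) (by unfold weightExp; split_ifs <;> omega) (by unfold weightExp; split_ifs <;> omega)
  -- For j ≥ 0 the weight exponent is solved by a nonpositive index, for j < 0 by a positive one;
  -- the other solutions modulo 2N leave the range.
  refine ⟨if 0 ≤ j then -(j + a) else a - j, ?_⟩
  ext m
  rw [Finset.mem_filter, Finset.mem_singleton, Finset.mem_Icc, qWeight_eq]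
  constructor
  · rintro ⟨h1, h2⟩
    rw [hm m h1] at h2
    unfold weightExp at h2
    split_ifs at * <;> omega
  · intro h
    have h1 : 1 - (M : ℤ) ≤ m ∧ m ≤ M := by split_ifs at * <;> omega
    rw [hm m h1]
    refine ⟨h1, ?_⟩
    unfold weightExp
    split_ifs at * <;> omega

theorem card_filter_double (hv : IsPrimitiveRoot v (2 * N)) (ha : 0 < a) (haN : 2 * a ≤ N) {M : ℕ}
    (hM : (M : ℤ) = N + 2 * a) [DecidableEq Kˣ] {j : ℤ}
    (hj : j ∈ doubleWeightsFirst a ∪ doubleWeightsSecond N a) :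
    ((Finset.Icc (1 - (M : ℤ)) M).filter fun m => qWeight v (v ^ (-a)) m = v ^ j).card = 2 := by
  rw [mem_doubleWeights] at hj
  rw [Finset.card_eq_two]
  have hm (m : ℤ) (hm : 1 - (M : ℤ) ≤ m ∧ m ≤ M) := zpow_eq_iff_of_abs_lt hv (i := weightExp a m)
    (j := j) (by unfold weightExp; split_ifs <;> omega) (by unfold weightExp; split_ifs <;> omega)
  -- One positive and one nonpositive index, each shifted by 2N when needed to fall in the range.
  refine ⟨if N - a ≤ j then a - j + 2 * N else a - j,
    if j ≤ a - N - 1 then -a - j - 2 * N else -a - j, by split_ifs <;> omega, ?_⟩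
  ext m
  rw [Finset.mem_filter, Finset.mem_insert, Finset.mem_singleton, Finset.mem_Icc, qWeight_eq]
  constructor
  · rintro ⟨h1, h2⟩
    rw [hm m h1] at h2
    unfold weightExp at h2
    split_ifs at * <;> omega
  · intro h
    have h1 : 1 - (M : ℤ) ≤ m ∧ m ≤ M := by split_ifs at * <;> omega
    rw [hm m h1]
    refine ⟨h1, ?_⟩
    unfold weightExp
    split_ifs at * <;> omega

theorem mem_exist {m : ℤ} : m ∈ existFirst a ∪ existSecond N a ∪ existThird N a ↔
    (-a + 1 ≤ m ∧ m ≤ a) ∨ (-N + 1 ≤ m ∧ m ≤ -2 * a) ∨ (2 * a + 1 ≤ m ∧ m ≤ N) ∨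
      (-N - a + 1 ≤ m ∧ m ≤ -N) ∨ (N + 1 ≤ m ∧ m ≤ N + a) := by
  simp only [existFirst, existSecond, existThird, Finset.mem_union, Finset.mem_Icc, or_assoc]

theorem mem_missing {m : ℤ} : m ∈ missingFirst a ∪ missingSecond N a ↔
    (-2 * a + 1 ≤ m ∧ m ≤ -a) ∨ (a + 1 ≤ m ∧ m ≤ 2 * a) ∨
      (-N - 2 * a + 1 ≤ m ∧ m ≤ -N - a) ∨ (N + a + 1 ≤ m ∧ m ≤ N + 2 * a) := by
  simp only [missingFirst, missingSecond, Finset.mem_union, Finset.mem_Icc, or_assoc]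

/-- Among the first 2N + 4a indices these m are the first occurrences of their weights; the missing
indices are the second ones. -/
theorem qWeight_ne_of_exist (hv : IsPrimitiveRoot v (2 * N)) (ha : 0 < a) (haN : 2 * a ≤ N) {m : ℤ}
    (hm : m ∈ existFirst a ∪ existSecond N a ∪ existThird N a) {c : ℤ} (hc : Succeeds c m) :
    qWeight v (v ^ (-a)) c ≠ qWeight v (v ^ (-a)) m := by
  rw [mem_exist] at hm
  rw [succeeds_iff] at hc
  obtain ⟨hc, -⟩ := hc
  rw [qWeight_eq, qWeight_eq, Ne, zpow_eq_iff_of_abs_lt hv]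
  all_goals
    unfold weightExp
    unfold position at hc
    split_ifs at * <;> omega

theorem exists_qWeight_eq_of_missing (hv : IsPrimitiveRoot v (2 * N)) (ha : 0 < a)
    (haN : 2 * a ≤ N) {m : ℤ} (hm : m ∈ missingFirst a ∪ missingSecond N a) :
    ∃ c ∈ existFirst a ∪ existSecond N a ∪ existThird N a, Succeeds c m ∧
      qWeight v (v ^ (-a)) c = qWeight v (v ^ (-a)) m := by
  rw [mem_missing] at hm
  -- The partner of m has the opposite type (positive or nonpositive), which shifts the index by 2a,
  -- and for the outer range also by 2N.
  refine ⟨if m ≤ -N - a then 2 * N + 2 * a + m else if m ≤ -a then 2 * a + m else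
    if m ≤ 2 * a then m - 2 * a else m - 2 * a - 2 * N, ?_⟩
  rw [mem_exist, succeeds_iff, qWeight_eq, qWeight_eq, zpow_eq_iff_of_abs_lt hv]
  · refine ⟨by split_ifs <;> omega, ⟨?_, by split_ifs <;> omega⟩, ?_⟩
    · unfold position
      split_ifs <;> omega
    · unfold weightExp
      split_ifs <;> omega
  all_goals
    unfold weightExp
    split_ifs <;> omega

theorem card_existFirst (ha : 0 < a) : ((existFirst a).card : ℤ) = 2 * a := by
  rw [existFirst, Int.card_Icc]
  omega

theorem card_Icc_union_Icc {b c d e : ℤ} (h : c < d) :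
    (Finset.Icc b c ∪ Finset.Icc d e).card = (c + 1 - b).toNat + (e + 1 - d).toNat := by
  rw [Finset.card_union_of_disjoint, Int.card_Icc, Int.card_Icc]
  rw [Finset.disjoint_left]
  intro i
  simp only [Finset.mem_Icc]
  omega

theorem card_existSecond (ha : 0 < a) (haN : 2 * a ≤ N) :
    ((existSecond N a).card : ℤ) = 2 * (N - 2 * a) := by
  rw [existSecond, card_Icc_union_Icc (by omega)]
  omega

theorem card_existThird (ha : 0 < a) : ((existThird N a).card : ℤ) = 2 * a := by
  rw [existThird, card_Icc_union_Icc (by omega)]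
  omega

theorem card_missingFirst (ha : 0 < a) : ((missingFirst a).card : ℤ) = 2 * a := by
  rw [missingFirst, card_Icc_union_Icc (by omega)]
  omega

theorem card_missingSecond (ha : 0 < a) : ((missingSecond N a).card : ℤ) = 2 * a := by
  rw [missingSecond, card_Icc_union_Icc (by omega)]
  omega

end Weights

/-! ### The radical and the perfect quotient -/

section Radical

variable {K : Type*} [Field K] {v u : Kˣ} {N : ℕ} {a : ℤ}

/-- A submodule of the polynomial representation as an ideal. -/
def idealOf (R : Submodule (DAHA K v u) (PolyRep K v u)) : Ideal (LaurentPolynomial K) where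
  carrier := {f | ofPoly K v u f ∈ R}
  zero_mem' := by
    change ofPoly K v u 0 ∈ R
    rw [map_zero]
    exact R.zero_mem
  add_mem' := fun {f g} hf hg => by
    change ofPoly K v u (f + g) ∈ R
    rw [map_add]
    exact R.add_mem hf hg
  smul_mem' c f hf := by
    have hX (x : LaurentPolynomial K) (hx : ofPoly K v u x ∈ R) :
        ofPoly K v u (T 1 * x) ∈ R := by
      rw [ofPoly_T_mul]
      exact R.smul_mem _ hx
    have hXi (x : LaurentPolynomial K) (hx : ofPoly K v u x ∈ R) :
        ofPoly K v u (T (-1) * x) ∈ R := by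
      have : ofPoly K v u (T (-1) * x) = ofGen K v u .Xinv • ofPoly K v u x :=
        (toPoly K v u).injective (by rw [toPoly_Xinv, LinearEquiv.apply_symm_apply,
          LinearEquiv.apply_symm_apply])
      rw [this]
      exact R.smul_mem _ hx
    have hT (n : ℤ) : ofPoly K v u (T n * f) ∈ R := by
      induction n using Int.induction_on with
      | zero => rwa [T_zero, one_mul]
      | succ n ih => rw [add_comm, T_add, mul_assoc]; exact hX _ ih
      | pred n ih => rw [sub_eq_neg_add, T_add, mul_assoc]; exact hXi _ ih
    change ofPoly K v u (c * f) ∈ R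
    induction c using LaurentPolynomial.induction_on' with
    | add p q hp hq => rw [add_mul, map_add]; exact R.add_mem hp hq
    | C_mul_T n b =>
      rw [mul_assoc, ← smul_eq_C_mul, map_smul]
      exact (R.restrictScalars K).smul_mem b (hT n)

theorem mem_idealOf {R : Submodule (DAHA K v u) (PolyRep K v u)} {f : LaurentPolynomial K} :
    f ∈ idealOf R ↔ ofPoly K v u f ∈ R := Iff.rfl

theorem eq_top_of_idealOf {R : Submodule (DAHA K v u) (PolyRep K v u)} (h : idealOf R = ⊤) :
    R = ⊤ := by
  rw [eq_top_iff]
  intro f _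
  have : toPoly K v u f ∈ idealOf R := h ▸ Submodule.mem_top
  rwa [mem_idealOf, LinearEquiv.symm_apply_apply] at this

/-- A proper submodule that contains the multiples of the generator consists of them. -/
theorem genPoly_dvd_of_mem_submodule [CharZero K] (hv : IsPrimitiveRoot v (2 * N)) (ha : 0 < a)
    (haN : 2 * a ≤ N) {R : Submodule (DAHA K v (v ^ (-a))) (PolyRep K v (v ^ (-a)))}
    (hG : ofPoly K v (v ^ (-a)) (genPoly v N a).toLaurent ∈ R) (hR : R ≠ ⊤)
    {f : PolyRep K v (v ^ (-a))} (hf : f ∈ R) :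
    (genPoly v N a).toLaurent ∣ toPoly K v (v ^ (-a)) f := by
  refine genPoly_dvd_of_mem hv ha haN (J := idealOf R) (fun f hf => ?_) (fun f hf => ?_) hG
    (fun h => hR (eq_top_of_idealOf h)) ?_
  · have : ofPoly K v (v ^ (-a)) (heckeOp (v ^ (-a)) f) =
        ofGen K v (v ^ (-a)) .T1 • ofPoly K v (v ^ (-a)) f :=
      (toPoly K v (v ^ (-a))).injective (by rw [toPoly_T1, LinearEquiv.apply_symm_apply,
        LinearEquiv.apply_symm_apply])
    rw [mem_idealOf, this]
    exact R.smul_mem _ hf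
  · have : ofPoly K v (v ^ (-a)) (piOp v f) =
        ofGen K v (v ^ (-a)) .pi • ofPoly K v (v ^ (-a)) f :=
      (toPoly K v (v ^ (-a))).injective (by rw [toPoly_pi, LinearEquiv.apply_symm_apply,
        LinearEquiv.apply_symm_apply])
    rw [mem_idealOf, this]
    exact R.smul_mem _ hf
  · rwa [mem_idealOf, LinearEquiv.symm_apply_apply]

theorem sq_ne_one (hv : IsPrimitiveRoot v (2 * N)) (ha : 0 < a) (haN : 2 * a ≤ N) :
    (v ^ (-a)) ^ 2 ≠ 1 := by
  intro h
  have : (N : ℤ) ∣ 0 - a := by rw [← sq_eq_iff hv, h]; simp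
  exact not_dvd_of_lt (by omega) this

theorem pairing_ofPoly_one (hu : u ^ 2 ≠ 1) (f : PolyRep K v u) :
    pairing K v u f (ofPoly K v u 1) = evalRho K v u f := by
  have := pairing_T K v hu f 0
  rwa [zpow_zero, Units.val_one, one_smul, T_zero] at this

theorem evalRho_of_mem_radical (hu : u ^ 2 ≠ 1) {f : PolyRep K v u} (hf : f ∈ radical K v u) :
    evalRho K v u f = 0 := by
  rw [← pairing_ofPoly_one hu]
  exact (mem_radical K v f).mp hf _

theorem mem_radical_of_T (f : PolyRep K v u)
    (h : ∀ n : ℤ, pairing K v u f (ofPoly K v u (T n)) = 0) : f ∈ radical K v u := by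
  rw [mem_radical]
  intro g
  obtain ⟨g, rfl⟩ := (ofPoly K v u).surjective g
  induction g using LaurentPolynomial.induction_on' with
  | add p q hp hq => rw [map_add, map_add, hp, hq, add_zero]
  | C_mul_T n b => rw [← smul_eq_C_mul, map_smul, map_smul, h, smul_zero]

/-- Multiples of G form a submodule on which the evaluation at v^a vanishes, so they pair to zero
with every X^n. The reverse inclusion is the minimality of proper submodules containing G, applied
to the radical. -/
theorem mem_radical_iff [CharZero K] (hv : IsPrimitiveRoot v (2 * N)) (ha : 0 < a)
    (haN : 2 * a ≤ N) (f : PolyRep K v (v ^ (-a))) :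
    f ∈ radical K v (v ^ (-a)) ↔ (genPoly v N a).toLaurent ∣ toPoly K v (v ^ (-a)) f := by
  have hu := sq_ne_one hv ha haN
  let W : Submodule K (PolyRep K v (v ^ (-a))) :=
    ((Ideal.span {(genPoly v N a).toLaurent}).restrictScalars K).comap
      (toPoly K v (v ^ (-a))).toLinearMap
  have hW (f) : f ∈ W ↔ (genPoly v N a).toLaurent ∣ toPoly K v (v ^ (-a)) f :=
    Ideal.mem_span_singleton
  have hgen : ∀ g, ∀ f ∈ W, ofGen K v (v ^ (-a)) g • f ∈ W := by
    intro g f hf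
    rw [hW] at hf ⊢
    cases g with
    | X => rw [toPoly_X]; exact hf.mul_left _
    | Xinv => rw [toPoly_Xinv]; exact hf.mul_left _
    | T0 =>
      rw [T0_eq, mul_smul, mul_smul, toPoly_pi, toPoly_T1, toPoly_pi]
      exact genPoly_dvd_piOp hv (genPoly_dvd_heckeOp hv ha haN (genPoly_dvd_piOp hv hf))
    | T1 => rw [toPoly_T1]; exact genPoly_dvd_heckeOp hv ha haN hf
    | pi => rw [toPoly_pi]; exact genPoly_dvd_piOp hv hf
  have hle (f) (hf : f ∈ W) : f ∈ radical K v (v ^ (-a)) := by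
    apply mem_radical_of_T
    intro n
    rw [pairing_T K v hu]
    have h1 := (hW _).mp (smul_mem_of_ofGen K v W hgen
      (((Y K v (v ^ (-a)))⁻¹ ^ n : (DAHA K v (v ^ (-a)))ˣ) : DAHA K v (v ^ (-a))) f hf)
    -- The root with exponent a is the evaluation point u⁻¹ = v^a.
    have h2 := (genPoly_dvd_iff hv _).mp h1 a (by rw [Finset.mem_Icc]; omega)
    have h3 := (dvd_pow_self _ (by rw [rootMult]; split_ifs <;> norm_num)).trans h2
    rw [lin_dvd_iff] at h3
    rw [evalRho_apply, show (v ^ (-a))⁻¹ = v ^ a by rw [zpow_neg, inv_inv]]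
    exact h3
  refine ⟨fun hf => ?_, fun hf => hle f ((hW f).mpr hf)⟩
  refine genPoly_dvd_of_mem_submodule hv ha haN (R := radicalSubmodule K v hu)
    (hle _ ((hW _).mpr (by rw [LinearEquiv.apply_symm_apply]))) (fun h => ?_) hf
  have h1 : ofPoly K v (v ^ (-a)) 1 ∈ radicalSubmodule K v hu := h ▸ Submodule.mem_top
  have h2 := evalRho_of_mem_radical hu h1
  rw [evalRho_one] at h2
  exact one_ne_zero h2

/-- A proper submodule strictly above the radical would contain G, hence would consist of multiples
of G, that is, lie in the radical. -/
theorem isSimpleModule_quotient [CharZero K] (hv : IsPrimitiveRoot v (2 * N)) (ha : 0 < a)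
    (haN : 2 * a ≤ N) : IsSimpleModule (DAHA K v (v ^ (-a)))
      (PolyRep K v (v ^ (-a)) ⧸ radicalSubmodule K v (sq_ne_one hv ha haN)) := by
  have hmem (f) : f ∈ radicalSubmodule K v (sq_ne_one hv ha haN) ↔ _ := mem_radical_iff hv ha haN f
  rw [isSimpleModule_iff_isCoatom]
  refine ⟨fun h => ?_, fun R hR => ?_⟩
  · have h1 : ofPoly K v (v ^ (-a)) 1 ∈ radicalSubmodule K v (sq_ne_one hv ha haN) :=
      h ▸ Submodule.mem_top
    have h2 := evalRho_of_mem_radical (sq_ne_one hv ha haN) h1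
    rw [evalRho_one] at h2
    exact one_ne_zero h2
  · by_contra hne
    refine hR.not_ge fun f hf => (hmem f).mpr (genPoly_dvd_of_mem_submodule hv ha haN ?_ hne hf)
    exact hR.le ((hmem _).mpr (by rw [LinearEquiv.apply_symm_apply]))

/-- The projection to the quotient as a linear map. -/
def quotMap (R : Submodule (DAHA K v u) (PolyRep K v u)) :
    LaurentPolynomial K →ₗ[K] PolyRep K v u ⧸ R :=
  (R.mkQ.restrictScalars K) ∘ₗ (ofPoly K v u).toLinearMap

theorem toPoly_Y (f : PolyRep K v u) :
    toPoly K v u ((Y K v u : DAHA K v u) • f) = yOp v u (toPoly K v u f) := by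
  change toPoly K v u ((ofGen K v u .pi * ofGen K v u .T1) • f) = _
  rw [mul_smul, toPoly_pi, toPoly_T1]
  rfl

theorem YOp_quotMap (R : Submodule (DAHA K v u) (PolyRep K v u)) (f : LaurentPolynomial K) :
    YOp K v u (PolyRep K v u ⧸ R) (quotMap R f) = quotMap R (yOp v u f) := by
  change (Y K v u : DAHA K v u) • R.mkQ (ofPoly K v u f) = R.mkQ (ofPoly K v u (yOp v u f))
  rw [← map_smul]
  congr 1
  apply (toPoly K v u).injective
  rw [toPoly_Y, LinearEquiv.apply_symm_apply, LinearEquiv.apply_symm_apply]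

theorem quotMap_surjective (R : Submodule (DAHA K v u) (PolyRep K v u)) :
    Function.Surjective (quotMap R) :=
  R.mkQ_surjective.comp (ofPoly K v u).surjective

theorem quotMap_eq_zero (R : Submodule (DAHA K v u) (PolyRep K v u)) (f : LaurentPolynomial K) :
    quotMap R f = 0 ↔ ofPoly K v u f ∈ R :=
  Submodule.Quotient.mk_eq_zero R

/-- A vector of the quotient that is a `Y`-eigenvector and vanishes at `q^{-ρ_k}` is zero. -/
theorem mem_radical_of_eigenvector (hu : u ^ 2 ≠ 1) {f : PolyRep K v u} {y : Kˣ}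
    (hf : YOp K v u (PolyRep K v u ⧸ radicalSubmodule K v hu) ((radicalSubmodule K v hu).mkQ f) =
      (y : K) • (radicalSubmodule K v hu).mkQ f)
    (h0 : evalRho K v u f = 0) : f ∈ radicalSubmodule K v hu := by
  apply mem_radical_of_T
  intro n
  rw [pairing_T K v hu, inv_zpow']
  have h1 := zpow_smul_eq K v u (Y K v u) y (x := (radicalSubmodule K v hu).mkQ f) hf (-n)
  -- The eigenvector equation holds only modulo the radical, which suffices because the evaluation
  -- vanishes on the radical.
  have h2 : ((Y K v u ^ (-n) : (DAHA K v u)ˣ) : DAHA K v u) • f - ((y ^ (-n) : Kˣ) : K) • f ∈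
      radicalSubmodule K v hu := by
    rw [← Submodule.Quotient.mk_eq_zero]
    exact sub_eq_zero.mpr h1
  have h3 := evalRho_of_mem_radical hu h2
  rwa [map_sub, LinearMap.map_smul (evalRho K v u), h0, smul_zero, sub_zero] at h3

/-- The evaluation descends to the quotient and is injective on each eigenspace there. -/
theorem finrank_eigenspace_le_one (hu : u ^ 2 ≠ 1) (y : Kˣ) : Module.finrank K
    ((YOp K v u (PolyRep K v u ⧸ radicalSubmodule K v hu)).eigenspace (y : K)) ≤ 1 := by
  let R := radicalSubmodule K v hu
  let e : (PolyRep K v u ⧸ R) →ₗ[K] K :=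
    { (QuotientAddGroup.lift R.toAddSubgroup (evalRho K v u).toAddMonoidHom
        fun f hf => evalRho_of_mem_radical hu hf) with
      map_smul' := fun c x => by
        obtain ⟨f, rfl⟩ := R.mkQ_surjective x
        exact map_smul (evalRho K v u) c f }
  have hinj : Function.Injective
      (e ∘ₗ ((YOp K v u (PolyRep K v u ⧸ R)).eigenspace (y : K)).subtype) := by
    rw [← LinearMap.ker_eq_bot, LinearMap.ker_eq_bot']
    rintro ⟨x, hx⟩ h0
    obtain ⟨f, rfl⟩ := R.mkQ_surjective x
    rw [Module.End.mem_eigenspace_iff] at hx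
    have := mem_radical_of_eigenvector hu hx h0
    apply Subtype.ext
    exact (Submodule.Quotient.mk_eq_zero R).mpr this
  have := LinearMap.finrank_le_finrank_of_injective hinj
  rwa [Module.finrank_self] at this

end Radical

/-! ### The spectrum of `Y` in the perfect quotient -/

section Spectrum

variable {K : Type*} [Field K] {v : Kˣ} {N : ℕ} {a : ℤ}

theorem exists_quotient_basis [CharZero K] (hv : IsPrimitiveRoot v (2 * N)) (ha : 0 < a)
    (haN : 2 * a ≤ N)
    {M : ℕ} (hM : (M : ℤ) = N + 2 * a) :
    ∃ b : Module.Basis (Fin (2 * M)) K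
      (PolyRep K v (v ^ (-a)) ⧸ radicalSubmodule K v (sq_ne_one hv ha haN)),
      ∀ i, b i = quotMap _ (T (seqIndex i)) := by
  refine exists_basis (isCoprime_genPoly_X (v := v)) genPoly_monic (by omega)
    (natDegree_genPoly ha haN hM)
    (quotMap_surjective _) fun f => ?_
  rw [quotMap_eq_zero]
  exact (mem_radical_iff hv ha haN _).trans (by rw [LinearEquiv.apply_symm_apply])

theorem exists_size (ha : 0 < a) : ∃ M : ℕ, (M : ℤ) = N + 2 * a :=
  ⟨(N + 2 * a).toNat, by omega⟩

theorem finiteDimensional_quotient [CharZero K] (hv : IsPrimitiveRoot v (2 * N)) (ha : 0 < a)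
    (haN : 2 * a ≤ N) :
    FiniteDimensional K
      (PolyRep K v (v ^ (-a)) ⧸ radicalSubmodule K v (sq_ne_one hv ha haN)) := by
  obtain ⟨M, hM⟩ := exists_size (N := N) ha
  obtain ⟨b, -⟩ := exists_quotient_basis hv ha haN hM
  exact Module.Finite.of_basis b

theorem finrank_quotient [CharZero K] (hv : IsPrimitiveRoot v (2 * N)) (ha : 0 < a)
    (haN : 2 * a ≤ N) :
    (Module.finrank K (PolyRep K v (v ^ (-a)) ⧸ radicalSubmodule K v (sq_ne_one hv ha haN)) : ℤ) =
      2 * N + 4 * a := by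
  obtain ⟨M, hM⟩ := exists_size (N := N) ha
  obtain ⟨b, -⟩ := exists_quotient_basis hv ha haN hM
  rw [Module.finrank_eq_card_basis b, Fintype.card_fin]
  push_cast
  omega

theorem finrank_simple [CharZero K] (hv : IsPrimitiveRoot v (2 * N)) (ha : 0 < a)
    (haN : 2 * a ≤ N) {j : ℤ}
    (hj : j ∈ simpleWeights N a) :
    Module.finrank K ((YOp K v (v ^ (-a)) (PolyRep K v (v ^ (-a)) ⧸
      radicalSubmodule K v (sq_ne_one hv ha haN))).maxGenEigenspace ((v ^ j : Kˣ) : K)) = 1 := by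
  classical
  obtain ⟨M, hM⟩ := exists_size (N := N) ha
  obtain ⟨b, hb⟩ := exists_quotient_basis hv ha haN hM
  have := finiteDimensional_quotient hv ha haN
  rw [finrank_maxGenEigenspace b hb (YOp_quotMap _), card_filter_simple hv ha haN hM hj]

theorem finrank_double [CharZero K] (hv : IsPrimitiveRoot v (2 * N)) (ha : 0 < a)
    (haN : 2 * a ≤ N) {j : ℤ}
    (hj : j ∈ doubleWeightsFirst a ∪ doubleWeightsSecond N a) :
    Module.finrank K ((YOp K v (v ^ (-a)) (PolyRep K v (v ^ (-a)) ⧸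
      radicalSubmodule K v (sq_ne_one hv ha haN))).maxGenEigenspace ((v ^ j : Kˣ) : K)) = 2 := by
  classical
  obtain ⟨M, hM⟩ := exists_size (N := N) ha
  obtain ⟨b, hb⟩ := exists_quotient_basis hv ha haN hM
  have := finiteDimensional_quotient hv ha haN
  rw [finrank_maxGenEigenspace b hb (YOp_quotMap _), card_filter_double hv ha haN hM hj]

/-- The listed weights account for (2N - 4a) + 2 · 4a = 2N + 4a dimensions, which is all of V. -/
theorem semisimplePart_quotient [CharZero K] (hv : IsPrimitiveRoot v (2 * N)) (ha : 0 < a)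
    (haN : 2 * a ≤ N) :
    let A := YOp K v (v ^ (-a)) (PolyRep K v (v ^ (-a)) ⧸
      radicalSubmodule K v (sq_ne_one hv ha haN))
    semisimplePart A = ⨆ j ∈ simpleWeights N a, A.eigenspace ((v ^ j : Kˣ) : K) ∧
    nonsemisimplePart A = ⨆ j ∈ doubleWeightsFirst a ∪ doubleWeightsSecond N a,
      A.maxGenEigenspace ((v ^ j : Kˣ) : K) ∧
    (Module.finrank K (semisimplePart A) : ℤ) = 2 * N - 4 * a ∧
    (Module.finrank K (nonsemisimplePart A) : ℤ) = 8 * a ∧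
    IsCompl (semisimplePart A) (nonsemisimplePart A) := by
  intro A
  have hfd := finiteDimensional_quotient hv ha haN
  have h1 (j) (hj : j ∈ simpleWeights N a) := finrank_simple hv ha haN hj
  have h2 (j) (hj : j ∈ doubleWeightsFirst a ∪ doubleWeightsSecond N a) :=
    finrank_double hv ha haN hj
  have c1 := card_simpleWeights ha haN
  have c2 := card_doubleWeights ha haN
  have s1 := Finset.sum_congr rfl h1
  have s2 := Finset.sum_congr rfl h2
  rw [Finset.sum_const, smul_eq_mul] at s1 s2
  obtain ⟨e1, e2, e3, e4, e5⟩ := semisimplePart_structure (A := A) (s := simpleWeights N a)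
    (t := doubleWeightsFirst a ∪ doubleWeightsSecond N a) (w := fun j => ((v ^ j : Kˣ) : K))
    (fun i hi j hj h => injOn_weights hv ha haN hi hj (Units.ext h)) disjoint_weights
    (fun j hj => maxGenEigenspace_eq_of_finrank_eq_one (h1 j hj))
    (fun j hj h => by
      have h3 := h2 j hj
      have h4 := finrank_eigenspace_le_one (v := v) (sq_ne_one hv ha haN) (v ^ j)
      have h5 : Module.finrank K (A.maxGenEigenspace ((v ^ j : Kˣ) : K)) =
        Module.finrank K (A.eigenspace ((v ^ j : Kˣ) : K)) := by rw [h]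
      change Module.finrank K (A.maxGenEigenspace ((v ^ j : Kˣ) : K)) = 2 at h3
      change Module.finrank K (A.eigenspace ((v ^ j : Kˣ) : K)) ≤ 1 at h4
      omega)
    (by
      have := finrank_quotient hv ha haN
      rw [Finset.sum_union disjoint_weights]
      refine (congrArg₂ _ s1 s2).trans ?_
      omega)
  refine ⟨e1, e2, ?_, ?_, e5⟩
  · rw [e3]
    refine (congrArg _ s1).trans ?_
    omega
  · rw [e4]
    refine (congrArg _ s2).trans ?_
    push_cast
    omega

theorem existsUnique_isMacdonald_of_mem (hv : IsPrimitiveRoot v (2 * N)) (ha : 0 < a)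
    (haN : 2 * a ≤ N) {m : ℤ} (hm : m ∈ existFirst a ∪ existSecond N a ∪ existThird N a) :
    ∃! E, IsMacdonald K v (v ^ (-a)) m E :=
  existsUnique_isMacdonald fun _ hc h => qWeight_ne_of_exist hv ha haN hm hc (Units.ext h)

theorem coeff_isMacdonald {u : Kˣ} {m : ℤ} {E : PolyRep K v u} (hE : IsMacdonald K v u m E) :
    (toPoly K v u E).coeff m = 1 := by
  have h := mt (hE.2 m) fun h => absurd (succeeds_iff.mp h).1 (lt_irrefl _)
  rw [not_not, coeff_sub, coeff_T, if_pos rfl, sub_eq_zero] at h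
  exact h

theorem coeff_isMacdonald_of_succeeds {u : Kˣ} {c m : ℤ} {E : PolyRep K v u}
    (hE : IsMacdonald K v u c E) (h : Succeeds c m) : (toPoly K v u E).coeff m = 0 := by
  have h1 := h.position_lt
  have h2 := mt (hE.2 m) fun h3 => absurd h3.position_lt (not_lt.mpr h1.le)
  have h4 : c ≠ m := by rintro rfl; exact lt_irrefl _ h1
  rwa [not_not, coeff_sub, coeff_T, if_neg h4, sub_zero] at h2

theorem isMacdonald_mem_spanT {u : Kˣ} {m : ℤ} {M : ℕ} (hm : 1 - (M : ℤ) ≤ m ∧ m ≤ M)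
    {E : PolyRep K v u} (hE : IsMacdonald K v u m E) :
    toPoly K v u E ∈ spanT (Set.Ico (1 - (M : ℤ)) (1 - M + (2 * M : ℕ))) := by
  have h1 : toPoly K v u E - T m ∈ spanT (Set.Ico (1 - (M : ℤ)) (1 - M + (2 * M : ℕ))) := by
    rw [mem_spanT]
    intro c hc
    have h2 := (hE.2 c hc).position_lt
    rw [Set.mem_Ico]
    unfold position at h2
    push_cast
    split_ifs at h2 <;> omega
  have h2 : (T m : LaurentPolynomial K) ∈ spanT (Set.Ico (1 - (M : ℤ)) (1 - M + (2 * M : ℕ))) :=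
    T_mem_spanT (by rw [Set.mem_Ico]; push_cast; omega)
  simpa using Submodule.add_mem _ h1 h2

theorem eq_zero_of_mem_radical [CharZero K] (hv : IsPrimitiveRoot v (2 * N)) (ha : 0 < a)
    (haN : 2 * a ≤ N) {M : ℕ} (hM : (M : ℤ) = N + 2 * a) {f : PolyRep K v (v ^ (-a))}
    (hf : toPoly K v _ f ∈ spanT (Set.Ico (1 - (M : ℤ)) (1 - M + (2 * M : ℕ))))
    (h : f ∈ radicalSubmodule K v (sq_ne_one hv ha haN)) : f = 0 := by
  have h1 := eq_zero_of_dvd_of_mem_spanT isCoprime_genPoly_X (natDegree_genPoly ha haN hM)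
    genPoly_monic hf ((mem_radical_iff hv ha haN f).mp h)
  exact (toPoly K v (v ^ (-a))).map_eq_zero_iff.mp h1

theorem mkQ_isMacdonald {u : Kˣ} (R : Submodule (DAHA K v u) (PolyRep K v u)) {m : ℤ}
    {E : PolyRep K v u} (hE : IsMacdonald K v u m E) :
    YOp K v u (PolyRep K v u ⧸ R) (R.mkQ E) = (qWeight v u m : K) • R.mkQ E :=
  congrArg R.mkQ hE.1

/-- If the value were zero, E_m would lie in the radical. Its exponents fit in a window of length
deg G, so it would vanish, contrary to its leading coefficient 1. -/
theorem evalRho_ne_zero [CharZero K] (hv : IsPrimitiveRoot v (2 * N)) (ha : 0 < a)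
    (haN : 2 * a ≤ N) {m : ℤ} (hm : m ∈ existFirst a ∪ existSecond N a ∪ existThird N a)
    {E : PolyRep K v (v ^ (-a))} (hE : IsMacdonald K v (v ^ (-a)) m E) :
    evalRho K v (v ^ (-a)) E ≠ 0 := by
  intro h
  obtain ⟨M, hM⟩ := exists_size (N := N) ha
  rw [mem_exist] at hm
  have h1 := mem_radical_of_eigenvector (sq_ne_one hv ha haN) (mkQ_isMacdonald _ hE) h
  have h2 := eq_zero_of_mem_radical hv ha haN hM (isMacdonald_mem_spanT (by omega) hE) h1
  have h3 := coeff_isMacdonald hE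
  rw [h2, map_zero] at h3
  exact zero_ne_one h3

/-- Let F be the polynomial of the earlier index with the same weight. The multiple of F with the
same value at v^a as E differs from E by an element of the radical, hence by zero; but only E
contains X^m. -/
theorem not_exists_isMacdonald [CharZero K] (hv : IsPrimitiveRoot v (2 * N)) (ha : 0 < a)
    (haN : 2 * a ≤ N) {m : ℤ} (hm : m ∈ missingFirst a ∪ missingSecond N a) :
    ¬ ∃ E, IsMacdonald K v (v ^ (-a)) m E := by
  rintro ⟨E, hE⟩
  obtain ⟨M, hM⟩ := exists_size (N := N) ha
  obtain ⟨c, hc, hcm, hw⟩ := exists_qWeight_eq_of_missing hv ha haN hm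
  obtain ⟨F, hF, -⟩ := existsUnique_isMacdonald_of_mem hv ha haN hc
  have hF0 := evalRho_ne_zero hv ha haN hc hF
  rw [mem_missing] at hm
  rw [mem_exist] at hc
  set R := radicalSubmodule K v (sq_ne_one hv ha haN) with hR
  set r : K := evalRho K v _ E / evalRho K v _ F with hr
  have h1 : E - r • F ∈ R := by
    refine mem_radical_of_eigenvector (sq_ne_one hv ha haN) (y := qWeight v (v ^ (-a)) m) ?_ ?_
    · have e1 := mkQ_isMacdonald R hE
      have e2 := mkQ_isMacdonald R hF
      have e3 : R.mkQ (E - r • F) = R.mkQ E - r • R.mkQ F := rfl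
      rw [hw] at e2
      rw [e3, map_sub, map_smul, e1, e2, smul_sub, smul_comm r]
    · rw [map_sub, LinearMap.map_smul (evalRho K v _), smul_eq_mul, hr, div_mul_cancel₀ _ hF0,
        sub_self]
  have h2 := eq_zero_of_mem_radical hv ha haN hM (f := E - r • F) (by
    rw [map_sub, map_smul]
    exact Submodule.sub_mem _ (isMacdonald_mem_spanT (by omega) hE)
      (Submodule.smul_mem _ _ (isMacdonald_mem_spanT (by omega) hF))) h1
  have h3 : (toPoly K v (v ^ (-a)) (E - r • F)).coeff m = 0 := by rw [h2, map_zero]; rfl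
  rw [map_sub, map_smul, coeff_sub, coeff_smul, coeff_isMacdonald hE,
    coeff_isMacdonald_of_succeeds hF hcm, mul_zero, sub_zero] at h3
  exact one_ne_zero h3

theorem semisimplePart_eq_span [CharZero K] (hv : IsPrimitiveRoot v (2 * N)) (ha : 0 < a)
    (haN : 2 * a ≤ N) :
    semisimplePart (YOp K v (v ^ (-a)) (PolyRep K v (v ^ (-a)) ⧸
      radicalSubmodule K v (sq_ne_one hv ha haN))) =
    Submodule.span K {x | ∃ m ∈ existSecond N a, ∃ E, IsMacdonald K v (v ^ (-a)) m E ∧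
      x = (radicalSubmodule K v (sq_ne_one hv ha haN)).mkQ E} := by
  rw [(semisimplePart_quotient hv ha haN).1]
  set R := radicalSubmodule K v (sq_ne_one hv ha haN) with hR
  have mem2 {m : ℤ} : m ∈ existSecond N a ↔
      (-N + 1 ≤ m ∧ m ≤ -2 * a) ∨ (2 * a + 1 ≤ m ∧ m ≤ N) := by
    simp only [existSecond, Finset.mem_union, Finset.mem_Icc]
  apply le_antisymm
  · refine iSup₂_le fun j hj => ?_
    obtain ⟨m, hm, hmj⟩ : ∃ m ∈ existSecond N a, weightExp a m = j := by
      rw [mem_simpleWeights] at hj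
      refine ⟨if 0 ≤ j then -(j + a) else a - j, ?_, ?_⟩
      · rw [mem2]
        split_ifs <;> omega
      · unfold weightExp
        split_ifs <;> omega
    have hm' : m ∈ existFirst a ∪ existSecond N a ∪ existThird N a :=
      Finset.mem_union_left _ (Finset.mem_union_right _ hm)
    obtain ⟨E, hE, -⟩ := existsUnique_isMacdonald_of_mem hv ha haN hm'
    have hE0 := evalRho_ne_zero hv ha haN hm' hE
    intro x hx
    obtain ⟨f, rfl⟩ := R.mkQ_surjective x
    have e1 := mkQ_isMacdonald R hE
    rw [qWeight_eq, hmj] at e1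
    rw [Module.End.mem_eigenspace_iff] at hx
    -- The multiple of E with the same evaluation as f; eigenvectors of equal weight and equal
    -- evaluation coincide in V.
    set r : K := evalRho K v _ f / evalRho K v _ E with hr
    have e3 : R.mkQ (f - r • E) = R.mkQ f - r • R.mkQ E := rfl
    have h1 : f - r • E ∈ R := by
      refine mem_radical_of_eigenvector (sq_ne_one hv ha haN) (y := v ^ j) ?_ ?_
      · rw [e3, map_sub, map_smul, e1, hx, smul_sub, smul_comm r]
      · rw [map_sub, LinearMap.map_smul (evalRho K v _), smul_eq_mul, hr, div_mul_cancel₀ _ hE0,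
          sub_self]
    have h2 : R.mkQ (f - r • E) = 0 := (Submodule.Quotient.mk_eq_zero R).mpr h1
    rw [e3, sub_eq_zero] at h2
    rw [h2]
    exact Submodule.smul_mem _ _ (Submodule.subset_span ⟨m, hm, E, hE, rfl⟩)
  · rw [Submodule.span_le]
    rintro _ ⟨m, hm, E, hE, rfl⟩
    have hj : weightExp a m ∈ simpleWeights N a := by
      rw [mem2] at hm
      rw [mem_simpleWeights]
      unfold weightExp
      split_ifs <;> omega
    refine Submodule.mem_iSup_of_mem _ (Submodule.mem_iSup_of_mem hj ?_)
    rw [Module.End.mem_eigenspace_iff, ← qWeight_eq]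
    exact mkQ_isMacdonald R hE

end Spectrum

end

end AOne

/-! ### Assembly of the theorem -/

theorem mainTheorem3 (K : Type*) [Field K] [CharZero K] (N : ℕ)
    (v : Kˣ) (hv : IsPrimitiveRoot v (2 * N))
    (k : ℤ) (hk : -(N : ℤ) ≤ 2 * k) (hk0 : k < 0) :
    -- `Rad` is a submodule for the double affine Hecke algebra with `t^{1/2} = q^{k/2} = v^k`
    ∃ Rad : Submodule (DAHA K v (v ^ k)) (PolyRep K v (v ^ k)),
      Rad.restrictScalars K = radical K v (v ^ k) ∧
      -- irreducibility and dimension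
      IsSimpleModule (DAHA K v (v ^ k)) (PolyRep K v (v ^ k) ⧸ Rad) ∧
      (Module.finrank K (PolyRep K v (v ^ k) ⧸ Rad) : ℤ) = 2 * N + 4 * |k| ∧
      -- existence and evaluations of the polynomials `E_m`
      ((existFirst |k|).card : ℤ) = 2 * |k| ∧
      ((existSecond N |k|).card : ℤ) = 2 * (N - 2 * |k|) ∧
      ((existThird N |k|).card : ℤ) = 2 * |k| ∧
      ((missingFirst |k|).card : ℤ) = 2 * |k| ∧
      ((missingSecond N |k|).card : ℤ) = 2 * |k| ∧
      (∀ m ∈ existFirst |k| ∪ existSecond N |k| ∪ existThird N |k|,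
        (∃! E, IsMacdonald K v (v ^ k) m E) ∧
        ∀ E, IsMacdonald K v (v ^ k) m E → evalRho K v (v ^ k) E ≠ 0) ∧
      (∀ m ∈ missingFirst |k| ∪ missingSecond N |k|, ¬ ∃ E, IsMacdonald K v (v ^ k) m E) ∧
      -- the `Y`-semisimple part
      (Module.finrank K (semisimplePart (YOp K v (v ^ k) (PolyRep K v (v ^ k) ⧸ Rad))) : ℤ) =
        2 * N - 4 * |k| ∧
      semisimplePart (YOp K v (v ^ k) (PolyRep K v (v ^ k) ⧸ Rad)) =
        Submodule.span K {x | ∃ m ∈ existSecond N |k|, ∃ E,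
          IsMacdonald K v (v ^ k) m E ∧ x = Rad.mkQ E} ∧
      (∀ i : ℕ, (i : ℤ) < N - 2 * |k| →
        qWeight v (v ^ k) (-2 * |k| - i) = v ^ (|k| + i) ∧
        qWeight v (v ^ k) (2 * |k| + 1 + i) = v ^ (-|k| - 1 - i)) ∧
      ((simpleWeights N |k|).card : ℤ) = 2 * N - 4 * |k| ∧
      Set.InjOn (fun j : ℤ => v ^ j) (simpleWeights N |k|) ∧
      (∀ j ∈ simpleWeights N |k|, Module.finrank K
        ((YOp K v (v ^ k) (PolyRep K v (v ^ k) ⧸ Rad)).maxGenEigenspace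
          ((v ^ j : Kˣ) : K)) = 1) ∧
      semisimplePart (YOp K v (v ^ k) (PolyRep K v (v ^ k) ⧸ Rad)) =
        ⨆ j ∈ simpleWeights N |k|,
          (YOp K v (v ^ k) (PolyRep K v (v ^ k) ⧸ Rad)).eigenspace ((v ^ j : Kˣ) : K) ∧
      -- the rest: Jordan 2-blocks
      IsCompl (semisimplePart (YOp K v (v ^ k) (PolyRep K v (v ^ k) ⧸ Rad)))
        (nonsemisimplePart (YOp K v (v ^ k) (PolyRep K v (v ^ k) ⧸ Rad))) ∧
      (Module.finrank K (nonsemisimplePart (YOp K v (v ^ k) (PolyRep K v (v ^ k) ⧸ Rad))) : ℤ) =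
        8 * |k| ∧
      ((doubleWeightsFirst |k| ∪ doubleWeightsSecond N |k|).card : ℤ) = 4 * |k| ∧
      Set.InjOn (fun j : ℤ => v ^ j)
        ((doubleWeightsFirst |k| ∪ doubleWeightsSecond N |k| : Finset ℤ) : Set ℤ) ∧
      nonsemisimplePart (YOp K v (v ^ k) (PolyRep K v (v ^ k) ⧸ Rad)) =
        ⨆ j ∈ doubleWeightsFirst |k| ∪ doubleWeightsSecond N |k|,
          (YOp K v (v ^ k) (PolyRep K v (v ^ k) ⧸ Rad)).maxGenEigenspace ((v ^ j : Kˣ) : K) ∧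
      iSupIndep (fun j : ↥(doubleWeightsFirst |k| ∪ doubleWeightsSecond N |k|) =>
        (YOp K v (v ^ k) (PolyRep K v (v ^ k) ⧸ Rad)).maxGenEigenspace
          ((v ^ (j : ℤ) : Kˣ) : K)) ∧
      ∀ j ∈ doubleWeightsFirst |k| ∪ doubleWeightsSecond N |k|,
        IsJordanTwoBlock (YOp K v (v ^ k) (PolyRep K v (v ^ k) ⧸ Rad)) ((v ^ j : Kˣ) : K)
          ((YOp K v (v ^ k) (PolyRep K v (v ^ k) ⧸ Rad)).maxGenEigenspace
            ((v ^ j : Kˣ) : K)) := by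
  obtain ⟨a, rfl⟩ : ∃ a, k = -a := ⟨-k, (neg_neg k).symm⟩
  have ha : 0 < a := by omega
  have haN : 2 * a ≤ N := by omega
  have hu := sq_ne_one hv ha haN
  have := finiteDimensional_quotient hv ha haN
  have habs : |(-a)| = a := by rw [abs_neg, abs_of_pos ha]
  rw [habs]
  obtain ⟨hsemi, hnon, hdim1, hdim2, hcompl⟩ := semisimplePart_quotient hv ha haN
  have hinj := injOn_weights hv ha haN
  refine ⟨radicalSubmodule K v hu, rfl, isSimpleModule_quotient hv ha haN,
    finrank_quotient hv ha haN, card_existFirst ha, card_existSecond ha haN, card_existThird ha,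
    card_missingFirst ha, card_missingSecond ha,
    fun m hm => ⟨existsUnique_isMacdonald_of_mem hv ha haN hm,
      fun E hE => evalRho_ne_zero hv ha haN hm hE⟩,
    fun m hm => not_exists_isMacdonald hv ha haN hm, hdim1,
    semisimplePart_eq_span hv ha haN, fun i hi => ?_, card_simpleWeights ha haN,
    hinj.mono (Finset.coe_subset.mpr Finset.subset_union_left),
    fun j hj => finrank_simple hv ha haN hj, hsemi, hcompl, hdim2, card_doubleWeights ha haN,
    hinj.mono (Finset.coe_subset.mpr Finset.subset_union_right), hnon, ?_,
    fun j hj => isJordanTwoBlock_of_finrank (finrank_double hv ha haN hj)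
      (finrank_eigenspace_le_one hu _)⟩
  · rw [qWeight_eq, qWeight_eq, weightExp, weightExp, if_neg (by omega), if_pos (by omega)]
    constructor <;> congr 1 <;> ring
  · refine (Module.End.independent_maxGenEigenspace _).comp
      (f := fun j : ↥(doubleWeightsFirst a ∪ doubleWeightsSecond N a) =>
        ((v ^ (j : ℤ) : Kˣ) : K)) ?_
    intro i j h
    exact Subtype.ext (hinj (Finset.mem_union_right _ i.2) (Finset.mem_union_right _ j.2)
      (Units.ext h))
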